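/- For $k,l\ge 0$ let $P(k,l)$ be the set of partitions of a set of $k$ upper and $l$ lower points, each row being ordered from left to right. A partition is noncrossing if, with the points listed as upper row from right to left followed by lower row from left to right, there are no points $a<b<c<d$ such that $a,c$ lie in one block and $b,d$ lie in a different block. A category of partitions is a collection $X$ of subsets $X(k,l)\subseteq P(k,l)$ ($k,l\ge0$) that is stable under tensor product (horizontal concatenation $P(k,l)\times P(k',l')\to P(k+k',l+l')$), composition (vertical concatenation $P(k,l)\times P(l,m)\to P(k,m)$, where the middle points, and the connected components containing middle points only, are removed), involution (turning upside down, $P(k,l)\to P(l,k)$) and rotation (moving the leftmost upper point to the left end of the lower row without changing the connections, conversely moving the leftmost lower point to the left end of the upper row, and likewise on the right side), and that contains the unit partition in $P(1,1)$ and the pair partition in $P(0,2)$ (in each case the two points are connected). It is a category of noncrossing partitions if all its members are noncrossing. Write $\langle S\rangle$ for the smallest category of partitions containing a set $S$ of partitions. Let $s\in P(0,1)$ be the singleton, $s\otimes s\in P(0,2)$ the double singleton (two unconnected points), $f\in P(0,4)$ the four block partition $\{1,2,3,4\}$, and $r\in P(0,4)$ the positioner partition $\{1\},\{2,4\},\{3\}$.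 Theorem. There are exactly seven categories of noncrossing partitions, namely the following pairwise distinct ones: 1. $\langle\emptyset\rangle$, the category of all noncrossing partitions all of whose blocks have size two; 2. $\langle f\rangle$, the category of all noncrossing partitions all of whose blocks have even size; 3. $\langle s\otimes s,f\rangle$, the category of all noncrossing partitions with an even number of blocks of odd size; 4. $\langle s,f\rangle$, the category of all noncrossing partitions; 5. $\langle s\otimes s\rangle$, the category of all noncrossing partitions with blocks of size one or two only, such that the number of blocks of size one is even and, when the points are labelled alternatingly $\oplus,\ominus,\oplus,\dots$ along the upper row from right to left and then along the lower row from left to right, every block of size two connects a point labelled $\oplus$ with a point labelled $\ominus$; 6. $\langle r\rangle$, the category of all noncrossing partitions with blocks of size one or two only and an even number of blocks of size one; 7. $\langle s\rangle$, the category of all noncrossing partitions with blocks of size one or two only. -/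

import Mathlib

namespace PartitionCategory

/-- `P(k,l)`: the partitions of `k` upper and `l` lower points, given by the equivalence
relation "is connected to". In each row the points are numbered from left to right;
`Sum.inl` marks the upper row, `Sum.inr` the lower row. The blocks of `p` are the elements
of `p.classes`. -/
abbrev Partn (k l : ℕ) : Type := Setoid (Fin k ⊕ Fin l)

/-- A collection of subsets `X(k,l) ⊆ P(k,l)`, for all `k, l ≥ 0`. -/
abbrev Collection : Type := ∀ k l : ℕ, Set (Partn k l)

/-- The counterclockwise position of a point, counted from zero: start at the very right upper
point, run through the upper row from right to left, then through the lower row from left to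
right. -/
def pos {k l : ℕ} : Fin k ⊕ Fin l → ℕ :=
  Sum.elim (fun i => (i.rev : ℕ)) (fun j => k + (j : ℕ))

/-- A partition is noncrossing if its lines can be drawn in the strip between the two rows without
crossings: there are no points `a`, `b`, `c`, `d` in this order around the boundary such that
`a`, `c` lie in one block and `b`, `d` lie in another block. -/
def Noncrossing {k l : ℕ} (p : Partn k l) : Prop :=
  ∀ a b c d : Fin k ⊕ Fin l, pos a < pos b → pos b < pos c → pos c < pos d →
    p a c → p b d → p a b

/-- Tensor product: horizontal concatenation, `p` on the left and `q` on the right. -/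
def tensor {k l k' l' : ℕ} (p : Partn k l) (q : Partn k' l') : Partn (k + k') (l + l') :=
  Setoid.map p (Sum.map (Fin.castAdd k') (Fin.castAdd l')) ⊔
    Setoid.map q (Sum.map (Fin.natAdd k) (Fin.natAdd l))

/-- Composition: vertical concatenation, `p` on top of `q`. On the upper, middle and lower points
take the equivalence relation generated by the lines of `p` and of `q`, then forget the middle
points. -/
def comp {k l m : ℕ} (p : Partn k l) (q : Partn l m) : Partn k m :=
  Setoid.comap (Sum.map id Sum.inr : Fin k ⊕ Fin m → Fin k ⊕ (Fin l ⊕ Fin m))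
    (Setoid.map p (Sum.map id Sum.inl) ⊔ Setoid.map q Sum.inr)

/-- Involution: turn the partition upside down. -/
def involution {k l : ℕ} (p : Partn k l) : Partn l k :=
  Setoid.comap Sum.swap p

/-- Rotation on the left: the first upper point becomes the first lower point. -/
def rotateLeft {k l : ℕ} (p : Partn (k + 1) l) : Partn k (l + 1) :=
  Setoid.comap
    (Sum.elim (fun i : Fin k => Sum.inl i.succ)
      (Fin.cons (Sum.inl 0) Sum.inr : Fin (l + 1) → Fin (k + 1) ⊕ Fin l)) p

/-- Rotation on the right: the last upper point becomes the last lower point. -/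
def rotateRight {k l : ℕ} (p : Partn (k + 1) l) : Partn k (l + 1) :=
  Setoid.comap
    (Sum.elim (fun i : Fin k => Sum.inl i.castSucc)
      (Fin.snoc Sum.inr (Sum.inl (Fin.last k)) : Fin (l + 1) → Fin (k + 1) ⊕ Fin l)) p

/-- The unit partition in `P(1,1)`, one upper point connected to one lower point. -/
def unitPartition : Partn 1 1 := ⊤

/-- The pair partition in `P(0,2)`, two connected lower points. -/
def pairPartition : Partn 0 2 := ⊤

/-- The singleton in `P(0,1)`. -/
def singletonPartition : Partn 0 1 := ⊤

/-- The double singleton in `P(0,2)`, the tensor product of two singletons. -/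
def doubleSingleton : Partn 0 2 := tensor singletonPartition singletonPartition

/-- The four block partition `{1,2,3,4}` in `P(0,4)`. -/
def fourBlock : Partn 0 4 := ⊤

/-- The positioner partition `{1},{2,4},{3}` in `P(0,4)`. -/
def positioner : Partn 0 4 := Setoid.ker (Sum.elim Fin.elim0 ![1, 2, 3, 2] : Fin 0 ⊕ Fin 4 → ℕ)

/-- A (full) category of partitions. `rotateLeft` and `rotateRight` are bijections
`P(k+1,l) → P(k,l+1)`, so the two rotation axioms are stability under both directions of the
rotation on either side. -/
structure IsCategory (X : Collection) : Prop where
  tensor_mem : ∀ {k l k' l' : ℕ} (p : Partn k l) (q : Partn k' l'),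
    p ∈ X k l → q ∈ X k' l' → tensor p q ∈ X (k + k') (l + l')
  comp_mem : ∀ {k l m : ℕ} (p : Partn k l) (q : Partn l m),
    p ∈ X k l → q ∈ X l m → comp p q ∈ X k m
  involution_mem : ∀ {k l : ℕ} (p : Partn k l), p ∈ X k l → involution p ∈ X l k
  rotateLeft_mem_iff : ∀ {k l : ℕ} (p : Partn (k + 1) l),
    rotateLeft p ∈ X k (l + 1) ↔ p ∈ X (k + 1) l
  rotateRight_mem_iff : ∀ {k l : ℕ} (p : Partn (k + 1) l),
    rotateRight p ∈ X k (l + 1) ↔ p ∈ X (k + 1) l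
  unit_mem : unitPartition ∈ X 1 1
  pair_mem : pairPartition ∈ X 0 2

/-- A category of noncrossing partitions. -/
structure IsNoncrossingCategory (X : Collection) : Prop extends IsCategory X where
  noncrossing : ∀ {k l : ℕ} (p : Partn k l), p ∈ X k l → Noncrossing p

/-- The category `⟨S⟩` generated by a set `S` of partitions: the intersection of all categories of
partitions that contain `S`. -/
def generated (S : Set (Σ k l : ℕ, Partn k l)) : Collection := fun k l =>
  {p | ∀ X : Collection, IsCategory X → (∀ s ∈ S, s.2.2 ∈ X s.1 s.2.1) → p ∈ X k l}

/-- All blocks have size one or two. -/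
def BlocksOneTwo {k l : ℕ} (p : Partn k l) : Prop :=
  ∀ b ∈ p.classes, b.ncard = 1 ∨ b.ncard = 2

/-- The number of blocks of size one is even. -/
def EvenSingletons {k l : ℕ} (p : Partn k l) : Prop :=
  Even {b ∈ p.classes | b.ncard = 1}.ncard

/-- Label the points counterclockwise, starting at the very right upper point, alternatingly by
`⊕` and `⊖` (`⊕` at even positions, `⊖` at odd ones). Every block of size two consists of a point
labelled `⊕` and a point labelled `⊖`. -/
def PairsAlternate {k l : ℕ} (p : Partn k l) : Prop :=
  ∀ b ∈ p.classes, b.ncard = 2 → (∃ x ∈ b, Even (pos x)) ∧ (∃ y ∈ b, Odd (pos y))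

end PartitionCategory

open PartitionCategory

open PartitionCategory

/-! Left rotation moves all points into one row, so a category is determined by its one-row
partitions. These are words over `ℕ` up to injective renaming, the blocks being the classes of equal
letters. Reading the upper row from right to left and then the lower row from left to right makes
left rotation invisible, right rotation a cyclic shift, involution a reversal, tensor product an
insertion of one word into another, and composition an iterated capping of neighbouring positions.
Via `toWords` and `ofWords` the theorem becomes the classification of the sets `L ⊆ ncWords` with
`IsWordCategory L`.

That the generators suffice: a nonempty noncrossing word contains a block of consecutive positions,
so every noncrossing word arises by inserting such blocks (`nc_induction`). The positioner lets
singletons travel freely, which settles the families restricted to even length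
(`nc_inter_count_inter_even_subset`). Words with alternating pairs are reduced by deleting two
neighbours (`exists_removable`).

That nothing else occurs: in a noncrossing word the letters between consecutive occurrences of `a`
appear nowhere else, so that stretch can be capped down to nothing or to one singleton (`collapse`).
This extracts generators from arbitrary words. Odd length yields the singleton, and a block of size
at least three yields the four block, by gluing a word to its mirror image (`mirror`). When all
lengths are even, an odd block yields the double singleton; if moreover all blocks have size one or
two, a pair that does not alternate yields the positioner. Hence `L` is determined by which of these
four words it contains (`exists_eq_sevenWords`), and the same four words tell the seven categories
apart. -/

namespace PartitionCategory

open List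

/-! ### Merging of letters and the calculus of word categories. -/

/-- The recoloring that identifies the letter `b` with the letter `a`. -/
def merge (a b x : ℕ) : ℕ := if x = b then a else x

theorem merge_right (a b : ℕ) : merge a b b = a := by simp [merge]

theorem merge_left (a b : ℕ) : merge a b a = a := by simp [merge]

theorem merge_of_ne {a b x : ℕ} (h : x ≠ b) : merge a b x = x := by simp [merge, h]

theorem map_merge_of_notMem {a b : ℕ} {w : List ℕ} (h : b ∉ w) : w.map (merge a b) = w := by
  conv_rhs => rw [← List.map_id w]
  exact List.map_congr_left fun x hx => merge_of_ne (by rintro rfl; exact h hx)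

theorem merge_eq_of_ne {a b x c : ℕ} (ha : c ≠ a) (h : merge a b x = c) : x = c := by
  unfold merge at h
  split_ifs at h with hx
  · exact absurd h.symm ha
  · exact h

/-- Every letter of the word is smaller than some bound. -/
theorem exists_fresh (w : List ℕ) : ∃ N, ∀ x ∈ w, x < N := by
  refine ⟨w.foldr max 0 + 1, ?_⟩
  induction w with
  | nil => simp
  | cons a w ih =>
    intro x hx
    rcases List.mem_cons.1 hx with rfl | hx
    · simp only [List.foldr_cons]; omega
    · have := ih x hx
      simp only [List.foldr_cons]; omega

/-- A set of words over `ℕ` that is invariant under renaming of letters and closed under the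
operations corresponding to those of a category of partitions, where a word encodes the partition
of its positions into the classes of equal letters. -/
structure IsWordCategory (L : Set (List ℕ)) : Prop where
  recolor : ∀ {w : List ℕ} {φ : ℕ → ℕ}, w ∈ L → Set.InjOn φ {x | x ∈ w} → w.map φ ∈ L
  append : ∀ {w w' : List ℕ}, w ∈ L → w' ∈ L → (∀ x ∈ w, x ∉ w') → w ++ w' ∈ L
  rotate : ∀ {a : ℕ} {w : List ℕ}, a :: w ∈ L → w ++ [a] ∈ L
  reverse : ∀ {w : List ℕ}, w ∈ L → w.reverse ∈ L
  cap : ∀ {w : List ℕ} {a b : ℕ}, w ++ [a, b] ∈ L → w.map (merge a b) ∈ L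
  pair : [0, 0] ∈ L

namespace IsWordCategory

variable {L : Set (List ℕ)}

theorem inter {L' : Set (List ℕ)} (h : IsWordCategory L) (h' : IsWordCategory L') :
    IsWordCategory (L ∩ L') where
  recolor hw hφ := ⟨h.recolor hw.1 hφ, h'.recolor hw.2 hφ⟩
  append hw hw' hd := ⟨h.append hw.1 hw'.1 hd, h'.append hw.2 hw'.2 hd⟩
  rotate hw := ⟨h.rotate hw.1, h'.rotate hw.2⟩
  reverse hw := ⟨h.reverse hw.1, h'.reverse hw.2⟩
  cap hw := ⟨h.cap hw.1, h'.cap hw.2⟩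
  pair := ⟨h.pair, h'.pair⟩

/-- Iterated rotation: words may be treated as cyclic, so operations at the end of a word become
available anywhere. -/
theorem append_comm (h : IsWordCategory L) {u v : List ℕ} (huv : u ++ v ∈ L) : v ++ u ∈ L := by
  induction u generalizing v with
  | nil => simpa using huv
  | cons a u ih =>
    have := ih (v := v ++ [a]) (by simpa using h.rotate huv)
    simpa using this

theorem insert (h : IsWordCategory L) {u v x : List ℕ} (huv : u ++ v ∈ L) (hx : x ∈ L)
    (hu : ∀ y ∈ x, y ∉ u) (hv : ∀ y ∈ x, y ∉ v) : u ++ x ++ v ∈ L := by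
  have h1 : (v ++ u) ++ x ∈ L := h.append (h.append_comm huv) hx (by
    intro y hy hyx
    rcases List.mem_append.1 hy with hy | hy
    · exact hv y hyx hy
    · exact hu y hyx hy)
  rw [List.append_assoc] at h1
  exact h.append_comm h1

theorem cap_mid (h : IsWordCategory L) {u v : List ℕ} {a b : ℕ} (hw : u ++ a :: b :: v ∈ L) :
    (u ++ v).map (merge a b) ∈ L := by
  have h1 : (v ++ u) ++ [a, b] ∈ L := by
    have : (u ++ [a, b]) ++ v ∈ L := by simpa using hw
    simpa using h.append_comm this
  have h2 := h.cap h1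
  rw [List.map_append] at h2 ⊢
  exact h.append_comm h2

theorem cap_self (h : IsWordCategory L) {u v : List ℕ} {a : ℕ} (hw : u ++ a :: a :: v ∈ L) :
    u ++ v ∈ L := by
  have := h.cap_mid hw
  rwa [show merge a a = id by funext x; unfold merge; split_ifs with hx <;> simp [hx],
    List.map_id] at this

/-- Once its only occurrence is removed, `b` leaves nothing to merge: capping with a singleton just
shortens the neighbouring block by one point. -/
theorem cap_notMem (h : IsWordCategory L) {u v : List ℕ} {a b : ℕ} (hw : u ++ a :: b :: v ∈ L)
    (hu : b ∉ u) (hv : b ∉ v) : u ++ v ∈ L := by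
  have := h.cap_mid hw
  rwa [map_merge_of_notMem (by simp [hu, hv])] at this

theorem cap_notMem_left (h : IsWordCategory L) {u v : List ℕ} {a b : ℕ}
    (hw : u ++ a :: b :: v ∈ L) (hu : a ∉ u) (hv : a ∉ v) : u ++ v ∈ L := by
  have h1 := h.reverse hw
  have h2 : v.reverse ++ b :: a :: u.reverse ∈ L := by simpa using h1
  have h3 := h.reverse (h.cap_notMem h2 (by simpa using hv) (by simpa using hu))
  simpa using h3

theorem pair_mem (h : IsWordCategory L) (a : ℕ) : [a, a] ∈ L := by
  have := h.recolor (φ := fun _ => a) h.pair (by intro x hx y hy _; simp_all)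
  simpa using this

theorem nil_mem (h : IsWordCategory L) : [] ∈ L := by
  have := h.cap_self (u := []) (v := []) h.pair
  simpa using this

/-- Iterated capping: if the words `x` and `x'` of equal length are glued along each other, the
letters of the remaining word are identified by a coequalizer `c` of the letters of `x` and
`x'`. -/
theorem contract (h : IsWordCategory L) {u v x x' : List ℕ} {c : ℕ → ℕ}
    (hw : u ++ x ++ x'.reverse ++ v ∈ L) (hlen : x.length = x'.length)
    (hc : x.map c = x'.map c)
    (huniv : ∀ d : ℕ → ℕ, x.map d = x'.map d → ∀ s ∈ u ++ v, ∀ t ∈ u ++ v, c s = c t → d s = d t) :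
    (u ++ v).map c ∈ L := by
  induction hn : x.length generalizing u v x x' with
  | zero =>
    obtain rfl : x = [] := by simpa using hn
    obtain rfl : x' = [] := by simpa using hlen.symm
    -- With nothing left to glue, `d = id` in `huniv` shows that `c` is injective on the remaining
    -- letters.
    exact h.recolor (by simpa using hw) fun s hs t ht hst => huniv id rfl s hs t ht hst
  | succ n ih =>
    obtain ⟨x, a, rfl⟩ : ∃ y a, x = y ++ [a] := by
      rcases List.eq_nil_or_concat x with rfl | ⟨y, b, rfl⟩
      · simp at hn
      · exact ⟨y, b, by simp⟩
    obtain ⟨x', b, rfl⟩ : ∃ y b, x' = y ++ [b] := by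
      rcases List.eq_nil_or_concat x' with rfl | ⟨y, b, rfl⟩
      · simp at hlen
      · exact ⟨y, b, by simp⟩
    have hlen' : x.length = x'.length := by simpa using hlen
    have hsplit : x.map c = x'.map c ∧ c a = c b := by
      rw [List.map_append, List.map_append] at hc
      have := List.append_inj hc (by simpa using hlen')
      simpa using this
    -- The neighbours `a` and `b` end `x` and `x'`, since `x'` is read backwards. As `c` already
    -- identifies them it survives the cap unchanged, and a competitor `d` after the cap pulls back
    -- to `d ∘ merge a b` before it.
    have hcm : c ∘ merge a b = c := by
      funext s
      unfold merge
      simp only [Function.comp]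
      split_ifs with hs
      · rw [hs, hsplit.2]
      · rfl
    have hcap := h.cap_mid (u := u ++ x) (a := a) (b := b) (v := x'.reverse ++ v)
      (by simpa using hw)
    have key := ih (u := u.map (merge a b)) (v := v.map (merge a b)) (x := x.map (merge a b))
      (x' := x'.map (merge a b)) (by simpa using hcap) (by simpa using hlen')
      (by rw [List.map_map, List.map_map, hcm]; exact hsplit.1) (by
        intro d hd s hs t ht hst
        rw [← List.map_append] at hs ht
        obtain ⟨s, hs1, rfl⟩ := List.mem_map.1 hs
        obtain ⟨t, ht1, rfl⟩ := List.mem_map.1 ht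
        refine huniv (d ∘ merge a b) ?_ s hs1 t ht1 ?_
        · rw [List.map_append, List.map_append, ← List.map_map, ← List.map_map, hd]
          simp [merge_left, merge_right]
        · have e := fun r => congrFun hcm r
          simp only [Function.comp] at e
          rwa [e, e] at hst) (by simpa using hn)
    rwa [← List.map_append, List.map_map, hcm] at key

end IsWordCategory

/-! ### Noncrossing words as iterated insertions of interval blocks. -/

/-- Noncrossing words: no two different letters alternate as `a b a b`. -/
def ncWords : Set (List ℕ) := {w | ∀ a b, [a, b, a, b] <+ w → a = b}

/-- Words in which the number of occurrences of each letter belongs to `B`. -/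
def countWords (B : Set ℕ) : Set (List ℕ) := {w | ∀ x ∈ w, w.count x ∈ B}

/-- Words of even length. -/
def evenWords : Set (List ℕ) := {w | Even w.length}

theorem ncWords_of_sublist {w w' : List ℕ} (h : w' ∈ ncWords) (hs : w <+ w') : w ∈ ncWords :=
  fun a b hab => h a b (hab.trans hs)

/-- Scan to the right for the first letter `a` that does not recur later; the invariant is that
every letter of `u` recurs in `v`. Any other letter after the first `a` would recur after the last
`a` and cross it, so the block of `a` is an interval. -/
theorem exists_eq_replicate_of_nc_aux (v : List ℕ) : ∀ u : List ℕ, u ++ v ∈ ncWords → v ≠ [] →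
    (∀ x ∈ u, x ∈ v) → ∃ (u' : List ℕ) (a n : ℕ) (v' : List ℕ),
      u ++ v = u' ++ replicate (n + 1) a ++ v' ∧ a ∉ u' ∧ a ∉ v' := by
  induction v with
  | nil => intro u _ h; exact absurd rfl h
  | cons a v ih =>
    intro u hnc _ hsub
    by_cases hav : a ∈ v
    · obtain ⟨u', b, n, v', h1, h2⟩ := ih (u ++ [a]) (by simpa using hnc)
        (by rintro rfl; simp at hav) (by
          intro x hx
          rcases List.mem_append.1 hx with hx | hx
          · rcases List.mem_cons.1 (hsub x hx) with rfl | h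
            · exact hav
            · exact h
          · simp at hx; exact hx ▸ hav)
      exact ⟨u', b, n, v', by simpa using h1, h2⟩
    · by_cases hau : a ∈ u
      · obtain ⟨u0, u1, rfl, hu0⟩ := List.eq_append_cons_of_mem hau
        have hall : ∀ x ∈ u1, x = a := by
          intro x hx
          by_contra hxa
          have hxv : x ∈ v := by
            have := hsub x (by simp [hx])
            simpa [hxa] using this
          refine hxa (hnc a x ?_).symm
          have e1 : [x] <+ u1 := List.singleton_sublist.2 hx
          have e2 : [x] <+ v := List.singleton_sublist.2 hxv
          have e3 : [a, x] ++ [a, x] <+ (a :: u1) ++ (a :: v) := (e1.cons_cons a).append (e2.cons_cons a)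
          refine e3.trans ?_
          simp
        refine ⟨u0, a, u1.length + 1, v, ?_, hu0, hav⟩
        conv_lhs => rw [List.eq_replicate_of_mem hall]
        rw [List.replicate_succ' (n := u1.length + 1), List.replicate_succ]
        simp
      · exact ⟨u, a, 0, v, by simp, hau, hav⟩

/-- A nonempty noncrossing word has a block consisting of consecutive positions. -/
theorem exists_eq_replicate_of_nc {w : List ℕ} (h : w ∈ ncWords) (hw : w ≠ []) :
    ∃ (u : List ℕ) (a n : ℕ) (v : List ℕ),
      w = u ++ replicate (n + 1) a ++ v ∧ a ∉ u ∧ a ∉ v := by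
  simpa using exists_eq_replicate_of_nc_aux w [] (by simpa using h) hw (by simp)

/-- Induction on noncrossing words with given block sizes, by insertion of interval blocks. -/
theorem nc_induction {B : Set ℕ} {P : List ℕ → Prop} (nil : P [])
    (step : ∀ (u : List ℕ) (a n : ℕ) (v : List ℕ), n + 1 ∈ B → a ∉ u → a ∉ v → P (u ++ v) →
      P (u ++ replicate (n + 1) a ++ v)) {w : List ℕ} (h : w ∈ ncWords) (hB : w ∈ countWords B) :
    P w := by
  induction hn : w.length using Nat.strong_induction_on generalizing w with
  | _ n ih =>
    by_cases hw : w = []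
    · rwa [hw]
    obtain ⟨u, a, m, v, rfl, hu, hv⟩ := exists_eq_replicate_of_nc h hw
    have hcount : ∀ x, x ≠ a → (u ++ replicate (m + 1) a ++ v).count x = (u ++ v).count x := by
      intro x hx
      simp [List.count_append, List.count_replicate, Ne.symm hx]
    refine step u a m v ?_ hu hv (ih _ ?_ ?_ ?_ rfl)
    · have := hB a (by simp)
      simpa [List.count_append, List.count_eq_zero_of_not_mem hu,
        List.count_eq_zero_of_not_mem hv] using this
    · subst hn; simp
    · exact ncWords_of_sublist h (by simp)
    · intro x hx
      have hxa : x ≠ a := by rintro rfl; simp [hu, hv] at hx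
      rw [← hcount x hxa]
      refine hB x ?_
      simp only [List.mem_append] at hx ⊢
      tauto

/-! ### Families of words forced by the generators. -/

namespace IsWordCategory

variable {L : Set (List ℕ)}

theorem nc_inter_count_subset (h : IsWordCategory L) {B : Set ℕ}
    (hB : ∀ n a, n + 1 ∈ B → replicate (n + 1) a ∈ L) : ncWords ∩ countWords B ⊆ L := by
  rintro w ⟨hw, hc⟩
  refine nc_induction (P := (· ∈ L)) h.nil_mem ?_ hw hc
  intro u a n v hn hu hv huv
  exact h.insert huv (hB n a hn) (by simp [hu]) (by simp [hv])

theorem recolor_four (h : IsWordCategory L) (hr : [1, 2, 3, 2] ∈ L) {s b t : ℕ} (h1 : s ≠ b)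
    (h2 : s ≠ t) (h3 : b ≠ t) : [s, b, t, b] ∈ L := by
  have := h.recolor (φ := fun n => if n = 1 then s else if n = 2 then b else t) hr (by
    intro x hx y hy hxy
    simp only [List.mem_cons, List.not_mem_nil, or_false, Set.mem_ofPred_eq] at hx hy
    rcases hx with rfl | rfl | rfl | rfl <;> rcases hy with rfl | rfl | rfl | rfl <;>
      simp_all [eq_comm])
  simpa using this

theorem recolor_two (h : IsWordCategory L) (hr : [0, 1] ∈ L) {s t : ℕ} (h1 : s ≠ t) :
    [s, t] ∈ L := by
  have := h.recolor (φ := fun n => if n = 0 then s else t) hr (by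
    intro x hx y hy hxy
    simp only [List.mem_cons, List.not_mem_nil, or_false, Set.mem_ofPred_eq] at hx hy
    rcases hx with rfl | rfl <;> rcases hy with rfl | rfl <;> simp_all [eq_comm])
  simpa using this

theorem recolor_const (h : IsWordCategory L) {n a : ℕ} (hr : replicate n a ∈ L) (b : ℕ) :
    replicate n b ∈ L := by
  have := h.recolor (φ := fun _ => b) hr (by
    intro x hx y hy hxy
    rw [List.eq_of_mem_replicate hx, List.eq_of_mem_replicate hy])
  simpa using this

/-- In a category containing the positioner partition a singleton may be moved by one step. -/
theorem move (h : IsWordCategory L) (hr : [1, 2, 3, 2] ∈ L) {u v : List ℕ} {s c : ℕ} (hu : s ∉ u)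
    (hv : s ∉ v) (hsc : s ≠ c) (hw : u ++ s :: c :: v ∈ L) : u ++ c :: s :: v ∈ L := by
  obtain ⟨N, hN⟩ := exists_fresh (s :: c :: (u ++ v))
  have hsN := hN s (by simp)
  have hcN := hN c (by simp)
  have hfu : ∀ k, N + k ∉ u := fun k hk => by
    have := hN (N + k) (by simp [hk]); omega
  have hfv : ∀ k, N + k ∉ v := fun k hk => by
    have := hN (N + k) (by simp [hk]); omega
  have hu0 := hfu 0
  have hv0 := hfv 0
  rw [Nat.add_zero] at hu0 hv0
  -- Insert `N, N+1, N, N+2` after `s c`. Capping `c` with the first `N` puts a block point `c`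
  -- between the singletons `N+1` and `N+2`; capping `s` with `N+1` removes both, and `N+2`, now
  -- behind `c`, is renamed `s`.
  have hX := h.rotate (h.recolor_four hr (s := N + 2) (b := N) (t := N + 1) (by omega) (by omega)
    (by omega))
  have h1 : (u ++ [s, c]) ++ [N, N + 1, N, N + 2] ++ v ∈ L := by
    refine h.insert (by simpa using hw) hX ?_ ?_
    · intro y hy
      simp only [List.mem_cons, List.not_mem_nil, or_false] at hy
      rcases hy with rfl | rfl | rfl | rfl <;> simp [hfu, hu0] <;> omega
    · intro y hy
      simp only [List.mem_cons, List.not_mem_nil, or_false] at hy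
      rcases hy with rfl | rfl | rfl | rfl <;> simp [hfv, hv0]
  have h2 := h.cap_mid (u := u ++ [s]) (a := c) (b := N) (v := (N + 1) :: N :: (N + 2) :: v)
    (by simpa using h1)
  have h3 : u ++ s :: (N + 1) :: c :: (N + 2) :: v ∈ L := by
    have e1 := map_merge_of_notMem (a := c) hu0
    have e2 := map_merge_of_notMem (a := c) hv0
    simp only [List.map_append, List.map_cons, e1, e2, merge_right, List.map_nil] at h2
    rw [merge_of_ne (by omega), merge_of_ne (by omega), merge_of_ne (by omega)] at h2
    simpa using h2
  have h4 : u ++ c :: (N + 2) :: v ∈ L := h.cap_notMem h3 (hfu 1) (by simp [hfv]; omega)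
  have h5 := h.recolor (φ := merge s (N + 2)) h4 (by
    have key : ∀ x, x ∈ u ++ c :: (N + 2) :: v → x ≠ s := by
      rintro x hx rfl
      simp only [List.mem_append, List.mem_cons] at hx
      rcases hx with hx | hx | hx | hx
      · exact hu hx
      · exact hsc hx
      · omega
      · exact hv hx
    intro x hx y hy hxy
    have hx' := key x hx
    have hy' := key y hy
    unfold merge at hxy
    split_ifs at hxy with h6 h7 h7
    · rw [h6, h7]
    · exact absurd hxy.symm hy'
    · exact absurd hxy hx'
    · exact hxy)
  have e1 := map_merge_of_notMem (a := s) (hfu 2)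
  have e2 := map_merge_of_notMem (a := s) (hfv 2)
  simp only [List.map_append, List.map_cons, e1, e2, merge_right] at h5
  rwa [merge_of_ne (by omega)] at h5

theorem move_front (h : IsWordCategory L) (hr : [1, 2, 3, 2] ∈ L) {u v : List ℕ} {s : ℕ}
    (hu : s ∉ u) (hv : s ∉ v) (hw : u ++ s :: v ∈ L) : s :: (u ++ v) ∈ L := by
  induction v generalizing u with
  | nil => simpa using h.append_comm hw
  | cons c v ih =>
    simp only [List.mem_cons, not_or] at hv
    have := ih (u := u ++ [c]) (by simp [hu, hv.1]) hv.2
      (by simpa using h.move hr hu hv.2 hv.1 hw)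
    simpa using this

/-- A category containing the positioner partition, the even blocks and the odd blocks together
with a singleton contains all noncrossing words of even length. -/
theorem nc_inter_count_inter_even_subset (h : IsWordCategory L) (hr : [1, 2, 3, 2] ∈ L) {B : Set ℕ}
    (heven : ∀ n a, n + 1 ∈ B → Even (n + 1) → replicate (n + 1) a ∈ L)
    (hodd : ∀ n a s, n + 1 ∈ B → Odd (n + 1) → s ≠ a → replicate (n + 1) a ++ [s] ∈ L) :
    ncWords ∩ countWords B ∩ evenWords ⊆ L := by
  rintro w ⟨⟨hw, hc⟩, he⟩
  -- Removing an odd block changes the parity of the length, so the induction also carries odd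
  -- words, compensated by one extra singleton in front.
  refine (nc_induction (B := B) (P := fun w => (Even w.length → w ∈ L) ∧
    (Odd w.length → ∀ s, s ∉ w → s :: w ∈ L)) ?_ ?_ hw hc).1 he
  · exact ⟨fun _ => h.nil_mem, by simp⟩
  intro u a n v hn hu hv ⟨ih1, ih2⟩
  have hlen : (u ++ replicate (n + 1) a ++ v).length = (u ++ v).length + (n + 1) := by
    simp; omega
  rw [hlen]
  rcases Nat.even_or_odd (n + 1) with hn1 | hn1
  · refine ⟨fun hl => ?_, fun hl s hs => ?_⟩
    · refine h.insert (ih1 ?_) (heven n a hn hn1) (by simp [hu]) (by simp [hv])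
      rw [Nat.even_add] at hl; tauto
    · simp only [List.mem_append, not_or, List.mem_replicate, not_and] at hs
      have hsa : s ≠ a := hs.1.2 (by omega)
      refine h.insert (u := s :: u) (ih2 ?_ s ?_) (heven n a hn hn1) ?_ (by simp [hv])
      · rw [Nat.odd_add] at hl; tauto
      · simp [hs.1.1, hs.2]
      · simp [hu, Ne.symm hsa]
  · refine ⟨fun hl => ?_, fun hl s hs => ?_⟩
    · obtain ⟨N, hN⟩ := exists_fresh (a :: (u ++ v))
      have haN := hN a (by simp)
      have hf : ∀ k, N + k ∉ u ++ v := fun k hk => by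
        have := hN (N + k) (List.mem_cons_of_mem _ hk); omega
      have hf0 := hf 0
      have hf1 := hf 1
      simp only [List.mem_append, not_or, Nat.add_zero] at hf0 hf1
      have h1 : N :: (u ++ v) ∈ L := ih2 (by rw [Nat.even_add', ] at hl; tauto) N (by simp [hf0])
      have h2 : (N :: u) ++ (replicate (n + 1) a ++ [N + 1]) ++ v ∈ L := by
        refine h.insert h1 (hodd n a (N + 1) hn hn1 (by omega)) ?_ ?_
        · intro y hy
          simp only [List.mem_append, List.mem_replicate, List.mem_singleton] at hy
          rcases hy with ⟨_, rfl⟩ | rfl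
          · simp [hu]; omega
          · simp [hf1]
        · intro y hy
          simp only [List.mem_append, List.mem_replicate, List.mem_singleton] at hy
          rcases hy with ⟨_, rfl⟩ | rfl
          · exact hv
          · exact hf1.2
      -- The singleton `N` comes from the induction hypothesis and `N + 1` from the inserted odd
      -- block. Brought together at the front, they cap each other away.
      have h3 := h.move_front hr (s := N + 1) (u := N :: u ++ replicate (n + 1) a) (v := v)
        (by simp [hf1]; omega) hf1.2 (by simpa using h2)
      have h4 := h.cap_notMem_left (u := []) (a := N + 1) (b := N)
        (v := u ++ replicate (n + 1) a ++ v) (by simpa using h3) (by simp)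
        (by simp [hf1]; omega)
      simpa using h4
    · simp only [List.mem_append, not_or, List.mem_replicate, not_and] at hs
      have hsa : s ≠ a := hs.1.2 (by omega)
      have h1 : u ++ v ∈ L := ih1 (by rw [Nat.odd_add'] at hl; tauto)
      have h2 : u ++ (replicate (n + 1) a ++ [s]) ++ v ∈ L := by
        refine h.insert h1 (hodd n a s hn hn1 hsa) ?_ ?_
        · intro y hy
          simp only [List.mem_append, List.mem_replicate, List.mem_singleton] at hy
          rcases hy with ⟨_, rfl⟩ | rfl
          · exact hu
          · exact hs.1.1
        · intro y hy
          simp only [List.mem_append, List.mem_replicate, List.mem_singleton] at hy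
          rcases hy with ⟨_, rfl⟩ | rfl
          · exact hv
          · exact hs.2
      have h3 := h.move_front hr (s := s) (u := u ++ replicate (n + 1) a) (v := v)
        (by simp [hs.1.1, hsa]) hs.2 (by simpa using h2)
      simpa using h3

/-- Capping a block of size `2(n+1)` against a four block joins them and loses two points, which
gives size `2(n+2)`. -/
theorem replicate_even_mem (h : IsWordCategory L) (hf : replicate 4 0 ∈ L) (n a : ℕ) :
    replicate (2 * n) a ∈ L := by
  induction n with
  | zero => simpa using h.nil_mem
  | succ n ih =>
    rcases n with _ | n
    · simpa using h.pair_mem a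
    · have h1 : replicate (2 * (n + 1)) a ++ replicate 4 (a + 1) ∈ L := by
        refine h.append ih (h.recolor_const hf _) ?_
        intro x hx
        rw [List.eq_of_mem_replicate hx]
        simp
      have h2 := h.cap_mid (u := replicate (2 * n + 1) a) (a := a) (b := a + 1)
        (v := replicate 3 (a + 1)) (by
          rw [show 2 * (n + 1) = (2 * n + 1) + 1 by ring, List.replicate_succ'] at h1
          simpa using h1)
      simp only [List.map_append, List.map_replicate, merge_right, merge_left] at h2
      rwa [← List.replicate_add] at h2

theorem replicate_mem (h : IsWordCategory L) (hf : replicate 4 0 ∈ L) (hs : [0] ∈ L) (n a : ℕ) :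
    replicate n a ∈ L := by
  rcases Nat.even_or_odd' n with ⟨m, rfl | rfl⟩
  · exact h.replicate_even_mem hf m a
  · have h1 : replicate (2 * (m + 1)) a ++ [a + 1] ∈ L :=
      h.append (h.replicate_even_mem hf _ a) (h.recolor_const (n := 1) (a := 0) hs (a + 1)) (by
        intro x hx
        rw [List.eq_of_mem_replicate hx]
        simp)
    rw [show 2 * (m + 1) = (2 * m + 1) + 1 by ring, List.replicate_succ'] at h1
    simpa using h.cap_notMem (u := replicate (2 * m + 1) a) (a := a) (b := a + 1) (v := [])
      (by simpa using h1) (by simp) (by simp)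

/-- Put the double singleton `s t` behind an even block and cap the block with `s`: it loses one
point and `t` remains. -/
theorem replicate_odd_append_mem (h : IsWordCategory L) (hf : replicate 4 0 ∈ L) (hs : [0, 1] ∈ L)
    (m a t : ℕ) (ht : t ≠ a) : replicate (2 * m + 1) a ++ [t] ∈ L := by
  have h0 : ∃ s, s ≠ a ∧ s ≠ t := ⟨a + t + 1, by omega, by omega⟩
  obtain ⟨s, hsa, hst⟩ := h0
  have h1 : replicate (2 * (m + 1)) a ++ [s, t] ∈ L :=
    h.append (h.replicate_even_mem hf _ a) (h.recolor_two hs hst) (by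
      intro x hx
      rw [List.eq_of_mem_replicate hx]
      simp [hsa.symm, ht.symm])
  rw [show 2 * (m + 1) = (2 * m + 1) + 1 by ring, List.replicate_succ'] at h1
  exact h.cap_notMem (u := replicate (2 * m + 1) a) (a := a) (b := s) (v := [t])
    (by simpa using h1) (by simp [hsa]) (by simp [hst])

theorem doubleton_mem_of_positioner (h : IsWordCategory L) (hr : [1, 2, 3, 2] ∈ L) : [0, 1] ∈ L := by
  have h1 := h.recolor_four hr (s := 2) (b := 0) (t := 1) (by simp) (by simp) (by simp)
  have h2 := h.cap_notMem_left (u := []) h1 (by simp) (by simp)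
  exact h.rotate h2

/-- Nest `3 4 4 4` inside `2 2 2 1` after its first letter. Capping `4` with `2` joins the two odd
blocks around the singleton `3`, and one more cap leaves `4 3 4 1`, a rotated positioner. -/
theorem positioner_mem (h : IsWordCategory L) (hf : replicate 4 0 ∈ L) (hs : [0, 1] ∈ L) :
    [1, 2, 3, 2] ∈ L := by
  have h1 := h.replicate_odd_append_mem hf hs 1 2 1 (by simp)
  have h2 := h.append_comm (h.replicate_odd_append_mem hf hs 1 4 3 (by simp))
  have h3 : [2] ++ [3, 4, 4, 4] ++ [2, 2, 1] ∈ L :=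
    h.insert (by simpa using h1) (by simpa using h2) (by simp) (by simp)
  have h4 := h.cap_mid (u := [2, 3, 4, 4]) (a := 4) (b := 2) (v := [2, 1]) (by simpa using h3)
  have h5 := h.cap_self (u := [4, 3]) (a := 4) (v := [4, 1]) (by simpa [merge] using h4)
  have h6 := h.append_comm (u := [4, 3, 4]) (v := [1]) h5
  have h7 := h.recolor (φ := fun n => if n = 4 then 2 else n) h6 (by
    intro x hx y hy hxy
    simp only [List.cons_append, List.nil_append, List.mem_cons, List.not_mem_nil, or_false,
      Set.mem_ofPred_eq] at hx hy
    rcases hx with rfl | rfl | rfl | rfl <;> rcases hy with rfl | rfl | rfl | rfl <;> simp_all)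
  simpa using h7

end IsWordCategory

/-! ### Closure of the candidate word sets under the category operations. -/

/-- The number of occurrences of a letter at even positions minus the number of its occurrences at
odd positions. -/
def signedCount (c : ℕ) : List ℕ → ℤ
  | [] => 0
  | x :: w => (if x = c then 1 else 0) - signedCount c w

/-- Words of even length in which each letter occurs at most twice, and letters occurring twice
occur at positions of different parity. -/
def altWords : Set (List ℕ) :=
  {w | Even w.length ∧ ∀ x, w.count x ≤ 2 ∧ (w.count x = 2 → signedCount x w = 0)}

theorem signedCount_append (c : ℕ) (u v : List ℕ) :
    signedCount c (u ++ v) = signedCount c u + (-1) ^ u.length * signedCount c v := by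
  induction u with
  | nil => simp [signedCount]
  | cons a u ih => simp only [List.cons_append, signedCount, ih, List.length_cons, pow_succ]; ring

theorem signedCount_eq_zero {c : ℕ} {w : List ℕ} (h : c ∉ w) : signedCount c w = 0 := by
  induction w with
  | nil => rfl
  | cons a w ih =>
    simp only [List.mem_cons, not_or] at h
    simp [signedCount, ih h.2, Ne.symm h.1]

theorem signedCount_reverse (c : ℕ) (w : List ℕ) :
    signedCount c w.reverse = -(-1) ^ w.length * signedCount c w := by
  induction w with
  | nil => simp [signedCount]
  | cons a w ih =>
    rw [List.reverse_cons, signedCount_append, ih]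
    simp only [signedCount, List.length_reverse, List.length_cons, pow_succ]
    ring

theorem signedCount_map {φ : ℕ → ℕ} {w : List ℕ} {c : ℕ} (h : ∀ x ∈ w, φ x = φ c → x = c) :
    signedCount (φ c) (w.map φ) = signedCount c w := by
  induction w with
  | nil => rfl
  | cons a w ih =>
    simp only [List.map_cons, signedCount]
    rw [ih fun x hx => h x (List.mem_cons_of_mem _ hx)]
    have : φ a = φ c ↔ a = c := ⟨h a (by simp), fun e => e ▸ rfl⟩
    simp [this]

theorem count_map {φ : ℕ → ℕ} {w : List ℕ} {c : ℕ} (h : ∀ x ∈ w, φ x = φ c → x = c) :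
    (w.map φ).count (φ c) = w.count c := by
  induction w with
  | nil => rfl
  | cons a w ih =>
    simp only [List.map_cons, List.count_cons]
    rw [ih fun x hx => h x (List.mem_cons_of_mem _ hx)]
    have : φ a = φ c ↔ a = c := ⟨h a (by simp), fun e => e ▸ rfl⟩
    simp [this]

theorem signedCount_map_merge {a b : ℕ} (hab : a ≠ b) (w : List ℕ) :
    signedCount a (w.map (merge a b)) = signedCount a w + signedCount b w := by
  induction w with
  | nil => rfl
  | cons x w ih =>
    simp only [List.map_cons, signedCount, ih]
    unfold merge
    by_cases hx : x = b
    · simp [hx, hab.symm]; ring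
    · simp [hx]; ring

theorem count_map_merge {a b : ℕ} (hab : a ≠ b) (w : List ℕ) :
    (w.map (merge a b)).count a = w.count a + w.count b := by
  induction w with
  | nil => rfl
  | cons x w ih =>
    simp only [List.map_cons, List.count_cons, ih]
    unfold merge
    by_cases hx : x = b
    · simp [hx, hab.symm]; ring
    · simp [hx]; ring

theorem merge_eq_iff {a b c : ℕ} (ha : c ≠ a) (hb : c ≠ b) (x : ℕ) :
    merge a b x = merge a b c → x = c := by
  rw [merge_of_ne hb]
  exact merge_eq_of_ne ha

theorem merge_self (a : ℕ) : merge a a = id := by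
  funext x
  unfold merge
  split_ifs with hx <;> simp [hx]

theorem notMem_map_merge {a b : ℕ} (hab : a ≠ b) (w : List ℕ) : b ∉ w.map (merge a b) := by
  rw [List.mem_map]
  rintro ⟨x, -, hx⟩
  unfold merge at hx
  split_ifs at hx with h
  · exact hab hx
  · exact h hx

theorem isWordCategory_evenWords : IsWordCategory evenWords where
  recolor hw _ := by simpa [evenWords] using hw
  append hw hw' _ := by
    simp only [evenWords, Set.mem_ofPred_eq, List.length_append] at *
    exact hw.add hw'
  rotate hw := by simpa [evenWords] using hw
  reverse hw := by simpa [evenWords] using hw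
  cap hw := by
    simp only [evenWords, Set.mem_ofPred_eq, List.length_append, List.length_cons, List.length_nil,
      List.length_map] at *
    rw [Nat.even_iff] at *
    omega
  pair := by simp [evenWords]

theorem exists_of_four_sublist_map {φ : ℕ → ℕ} {w : List ℕ} {a b c d : ℕ}
    (h : [a, b, c, d] <+ w.map φ) :
    ∃ a' b' c' d', [a', b', c', d'] <+ w ∧ a = φ a' ∧ b = φ b' ∧ c = φ c' ∧ d = φ d' := by
  obtain ⟨l, hl, hm⟩ := List.sublist_map_iff.1 h
  have hlen : l.length = 4 := by simpa using (congrArg List.length hm).symm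
  obtain ⟨a', b', c', d', rfl⟩ := List.length_eq_four.1 hlen
  exact ⟨a', b', c', d', hl, by simpa using hm⟩

theorem isWordCategory_ncWords : IsWordCategory ncWords where
  recolor := by
    intro w φ hw hφ a b hab
    obtain ⟨a1, b1, a2, b2, hl, e1, e2, e3, e4⟩ := exists_of_four_sublist_map hab
    have m := hl.subset
    have ha : a1 = a2 := hφ (m (by simp)) (m (by simp)) (e1.symm.trans e3)
    have hb : b1 = b2 := hφ (m (by simp)) (m (by simp)) (e2.symm.trans e4)
    subst ha hb
    rw [e1, e2, hw _ _ hl]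
  append := by
    intro w w' hw hw' hd a b hab
    obtain ⟨l1, l2, h, h1, h2⟩ := List.sublist_append_iff.1 hab
    have m1 := h1.subset
    have m2 := h2.subset
    match l1, h with
    | [], h => exact hw' a b (by simpa [h] using h2)
    | [_], h =>
      simp only [List.cons_append, List.nil_append, List.cons.injEq] at h
      obtain ⟨rfl, rfl⟩ := h
      exact absurd (m2 (by simp)) (hd a (m1 (by simp)))
    | [_, _], h =>
      simp only [List.cons_append, List.nil_append, List.cons.injEq] at h
      obtain ⟨rfl, rfl, rfl⟩ := h
      exact absurd (m2 (by simp)) (hd a (m1 (by simp)))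
    | [_, _, _], h =>
      simp only [List.cons_append, List.nil_append, List.cons.injEq] at h
      obtain ⟨rfl, rfl, rfl, rfl⟩ := h
      exact absurd (m2 (by simp)) (hd b (m1 (by simp)))
    | [_, _, _, _], h =>
      simp only [List.cons_append, List.nil_append, List.cons.injEq] at h
      obtain ⟨rfl, rfl, rfl, rfl, rfl⟩ := h
      exact hw a b h1
    | _ :: _ :: _ :: _ :: _ :: _, h => simp at h
  rotate := by
    intro c w hw a b hab
    obtain ⟨l1, l2, h, h1, h2⟩ := List.sublist_append_iff.1 hab
    rcases List.sublist_singleton.1 h2 with rfl | rfl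
    · rw [List.append_nil] at h
      exact hw a b (h ▸ h1.trans (List.sublist_cons_self c w))
    · obtain ⟨rfl, hc⟩ : l1 = [a, b, a] ∧ b = c := by
        have : [a, b, a] ++ [b] = l1 ++ [c] := h
        have := List.append_inj' this rfl
        simpa [eq_comm] using this
      subst hc
      exact (hw b a (h1.cons_cons b)).symm
  reverse := by
    intro w hw a b hab
    have := List.reverse_sublist.2 hab
    exact (hw b a (by simpa using this)).symm
  cap := by
    intro w a b hw x y hxy
    obtain ⟨x1, y1, x2, y2, hl, e1, e2, e3, e4⟩ := exists_of_four_sublist_map hxy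
    by_contra hne
    -- A crossing created by the merge can use the merged letter for only one of its two blocks. The
    -- occurrence of `a` or `b` at the end of `w ++ [a, b]` then completes a crossing that was there
    -- before the cap.
    have hsub : ∀ z, (z = a ∨ z = b) → [x1, y1, x2, y2, z] <+ w ++ [a, b] := by
      intro z hz
      have : [z] <+ [a, b] := by rw [List.singleton_sublist]; simpa using hz
      exact hl.append this
    have hsplit : ∀ {p q : ℕ}, merge a b p = merge a b q → p ≠ q →
        (p = a ∨ p = b) ∧ (q = a ∨ q = b) := by
      intro p q h hpq
      unfold merge at h
      split_ifs at h with h1 h2 h2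
      · exact absurd (h1.trans h2.symm) hpq
      · exact ⟨Or.inr h1, Or.inl h.symm⟩
      · exact ⟨Or.inl h, Or.inr h2⟩
      · exact absurd h hpq
    have hxy' : ∀ {p q : ℕ}, merge a b p = x → merge a b q = y → p ≠ q := by
      rintro p q h1 h2 rfl
      exact hne (h1.symm.trans h2)
    by_cases hx : x1 = x2
    · by_cases hy : y1 = y2
      · subst hx hy
        exact hxy' e1.symm e2.symm (hw _ _ (hl.trans (List.sublist_append_left _ _)))
      · have := hsplit (e2.symm.trans e4) hy
        have h5 := hsub y1 this.1
        subst hx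
        refine hxy' e1.symm e2.symm (hw _ _ (List.Sublist.trans ?_ h5))
        simp
    · have := hsplit (e1.symm.trans e3) hx
      by_cases hy : y1 = y2
      · have h5 := hsub x2 this.2
        subst hy
        refine hxy' e3.symm e2.symm (hw _ _ (List.Sublist.trans ?_ h5)).symm
        simp
      · have h6 := hsplit (e2.symm.trans e4) hy
        refine hne ?_
        have ha : merge a b a = a := merge_left a b
        have hb : merge a b b = a := merge_right a b
        rw [e1, e2]
        rcases this.1 with h | h <;> rcases h6.1 with h' | h' <;> rw [h, h'] <;> simp [ha, hb]
  pair := by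
    intro a b h
    have := h.length_le
    simp at this

/-- A cap either joins blocks of sizes `m + 1` and `n + 1` or takes two points from one block.
Positivity is required because a block that vanishes imposes no condition. -/
theorem isWordCategory_countWords {B : Set ℕ} (h2 : 2 ∈ B)
    (hmerge : ∀ m n, m + 1 ∈ B → n + 1 ∈ B → 0 < m + n → m + n ∈ B)
    (hself : ∀ n, n + 2 ∈ B → 0 < n → n ∈ B) : IsWordCategory (countWords B) where
  recolor := by
    intro w φ hw hφ y hy
    obtain ⟨x, hx, rfl⟩ := List.mem_map.1 hy
    rw [count_map fun z hz h => hφ hz hx h]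
    exact hw x hx
  append := by
    intro w w' hw hw' hd x hx
    rw [List.count_append]
    rcases List.mem_append.1 hx with hx | hx
    · rw [List.count_eq_zero_of_not_mem (hd x hx)]
      exact hw x hx
    · rw [List.count_eq_zero_of_not_mem (l := w) fun h => hd x h hx, zero_add]
      exact hw' x hx
  rotate := by
    intro a w hw x hx
    have := hw x (by simpa [or_comm] using hx)
    simpa [List.count_append, List.count_cons] using this
  reverse := by
    intro w hw x hx
    rw [List.count_reverse]
    exact hw x (by simpa using hx)
  cap := by
    intro w a b hw x hx
    by_cases hab : a = b
    · subst hab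
      rw [merge_self, List.map_id] at hx ⊢
      have := hw x (by simp [hx])
      by_cases hxa : x = a
      · subst hxa
        refine hself _ ?_ (List.count_pos_iff.2 hx)
        simpa [List.count_append] using this
      · simpa [List.count_append, List.count_cons, Ne.symm hxa] using this
    · by_cases hxa : x = a
      · subst hxa
        have e1 := hw x (by simp)
        have e2 := hw b (by simp)
        have hpos := List.count_pos_iff.2 hx
        rw [count_map_merge hab] at hpos ⊢
        refine hmerge _ _ ?_ ?_ hpos
        · simpa [List.count_append, List.count_cons, Ne.symm hab] using e1
        · simpa [List.count_append, List.count_cons, hab] using e2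
      · have hxb : x ≠ b := by
          rintro rfl
          exact notMem_map_merge hab w hx
        have hxw : x ∈ w := by
          obtain ⟨y, hy, rfl⟩ := List.mem_map.1 hx
          rw [merge_eq_of_ne hxa rfl] at hy
          exact hy
        have e := count_map (φ := merge a b) (w := w) (c := x) fun z _ => merge_eq_iff hxa hxb z
        rw [merge_of_ne hxb] at e
        rw [e]
        have := hw x (by simp [hxw])
        simpa [List.count_append, List.count_cons, Ne.symm hxa, Ne.symm hxb] using this
  pair := by
    intro x hx
    have : x = 0 := by simpa using hx
    subst this
    simpa using h2

/-- In the cap, `w` has even length, so the final `a` and `b` carry signs `+1` and `-1`. If the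
merged letter occurs twice in the result, both letters formed alternating pairs before; the rest of
`a` has sign `-1`, the rest of `b` has `+1`, and the sum vanishes. -/
theorem isWordCategory_altWords : IsWordCategory altWords where
  recolor := by
    rintro w φ ⟨he, hw⟩ hφ
    refine ⟨by simpa using he, fun y => ?_⟩
    by_cases hy : y ∈ w.map φ
    · obtain ⟨x, hx, rfl⟩ := List.mem_map.1 hy
      rw [count_map fun z hz h => hφ hz hx h, signedCount_map fun z hz h => hφ hz hx h]
      exact hw x
    · rw [List.count_eq_zero_of_not_mem hy]
      simp
  append := by
    rintro w w' ⟨he, hw⟩ ⟨he', hw'⟩ hd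
    refine ⟨by simpa using he.add he', fun x => ?_⟩
    rw [List.count_append, signedCount_append, he.neg_one_pow, one_mul]
    by_cases hx : x ∈ w
    · rw [List.count_eq_zero_of_not_mem (hd x hx), signedCount_eq_zero (hd x hx)]
      simpa using hw x
    · rw [List.count_eq_zero_of_not_mem hx, signedCount_eq_zero hx]
      simpa using hw' x
  rotate := by
    rintro a w ⟨he, hw⟩
    refine ⟨by simpa using he, fun x => ?_⟩
    have hodd : Odd w.length := by
      rw [List.length_cons, Nat.even_add_one, Nat.not_even_iff_odd] at he
      exact he
    have := hw x
    rw [List.count_append, signedCount_append, hodd.neg_one_pow]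
    rw [List.count_cons] at this
    simp only [signedCount, List.count_cons, List.count_nil] at this ⊢
    refine ⟨by omega, fun h => ?_⟩
    have := this.2 (by omega)
    linarith
  reverse := by
    rintro w ⟨he, hw⟩
    refine ⟨by simpa using he, fun x => ?_⟩
    rw [List.count_reverse, signedCount_reverse, he.neg_one_pow]
    simpa using hw x
  cap := by
    rintro w a b ⟨he, hw⟩
    have he' : Even w.length := by
      simp only [List.length_append, List.length_cons, List.length_nil] at he
      rw [Nat.even_iff] at *
      omega
    refine ⟨by simpa using he', fun x => ?_⟩
    have hx := hw x
    rw [List.count_append, signedCount_append, he'.neg_one_pow] at hx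
    simp only [signedCount, List.count_cons, List.count_nil, beq_iff_eq] at hx
    by_cases hab : a = b
    · subst hab
      rw [merge_self, List.map_id]
      by_cases hxa : a = x
      · simp [hxa] at hx
        constructor <;> omega
      · simpa [hxa] using hx
    · by_cases hxa : x = a
      · subst hxa
        have hb := hw b
        rw [List.count_append, signedCount_append, he'.neg_one_pow] at hb
        simp only [signedCount, List.count_cons, List.count_nil, beq_iff_eq] at hb
        rw [count_map_merge hab, signedCount_map_merge hab]
        simp [hab, Ne.symm hab] at hx hb
        refine ⟨by omega, fun h => ?_⟩
        have := hx.2 (by omega)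
        have := hb.2 (by omega)
        omega
      · by_cases hxb : x = b
        · subst hxb
          rw [List.count_eq_zero_of_not_mem (notMem_map_merge hab w)]
          simp
        · have e := count_map (φ := merge a b) (w := w) (c := x) fun z _ => merge_eq_iff hxa hxb z
          have e' := signedCount_map (φ := merge a b) (w := w) (c := x)
            fun z _ => merge_eq_iff hxa hxb z
          rw [merge_of_ne hxb] at e e'
          rw [e, e']
          simpa [Ne.symm hxa, Ne.symm hxb] using hx
  pair := by
    refine ⟨by simp, fun x => ?_⟩
    by_cases hx : x = 0
    · subst hx; simp [signedCount]
    · simp [Ne.symm hx]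

/-! ### Reduction of alternating noncrossing words. -/

/-- Splitting a word at the first two occurrences of a letter. -/
theorem exists_split_of_two_le_count {a : ℕ} {w : List ℕ} (h : 2 ≤ w.count a) :
    ∃ u x z, w = u ++ a :: (x ++ a :: z) ∧ a ∉ u ∧ a ∉ x := by
  obtain ⟨u, v, rfl, hu⟩ := List.eq_append_cons_of_mem
    (List.count_pos_iff.1 (show 0 < w.count a by omega))
  have hv : a ∈ v := by
    rw [List.count_append, List.count_eq_zero_of_not_mem hu, List.count_cons_self] at h
    exact List.count_pos_iff.1 (by omega)
  obtain ⟨x, z, rfl, hx⟩ := List.eq_append_cons_of_mem hv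
  exact ⟨u, x, z, rfl, hu, hx⟩

theorem signedCount_split {u x z : List ℕ} {a : ℕ} (hu : a ∉ u) (hx : a ∉ x) (hz : a ∉ z) :
    signedCount a (u ++ a :: (x ++ a :: z)) = 0 ↔ Even x.length := by
  rw [signedCount_append, signedCount_eq_zero hu]
  simp only [signedCount, signedCount_append, signedCount_eq_zero hx, signedCount_eq_zero hz]
  rcases Nat.even_or_odd x.length with h | h
  · simp [h.neg_one_pow, h]
  · simp [h.neg_one_pow, Nat.not_even_iff_odd.2 h]

theorem nc_between_disjoint {u x z : List ℕ} {a : ℕ} (h : u ++ a :: (x ++ a :: z) ∈ ncWords)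
    (hx : a ∉ x) : ∀ y ∈ x, y ∉ u ∧ y ∉ z := by
  intro y hy
  have hya : y ≠ a := by rintro rfl; exact hx hy
  have e : [y] <+ x := List.singleton_sublist.2 hy
  refine ⟨fun hu => ?_, fun hz => ?_⟩
  · have e' : [y] <+ u := List.singleton_sublist.2 hu
    refine hya (h y a ?_)
    exact e'.append ((e.append ((List.nil_sublist z).cons_cons a)).cons_cons a)
  · have e' : [y] <+ z := List.singleton_sublist.2 hz
    refine hya (h a y ?_).symm
    exact (List.nil_sublist u).append ((e.append (e'.cons_cons a)).cons_cons a)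

theorem notMem_of_count_le_two {u x z : List ℕ} {a : ℕ}
    (h : (u ++ a :: (x ++ a :: z)).count a ≤ 2) : a ∉ u ∧ a ∉ x ∧ a ∉ z := by
  simp only [List.count_append, List.count_cons_self] at h
  refine ⟨?_, ?_, ?_⟩ <;> rw [← List.count_eq_zero] <;> omega

/-- In a nonempty noncrossing word with alternating pairs there are two neighbouring positions that
form a pair or are two singletons. -/
theorem exists_removable {w : List ℕ} (hnc : w ∈ ncWords) (halt : w ∈ altWords) (hw : w ≠ []) :
    ∃ u s t v, w = u ++ s :: t :: v ∧ (s = t ∨ (s ≠ t ∧ s ∉ u ++ v ∧ t ∉ u ++ v)) := by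
  -- Descend on the gap `x` inside a pair, whose length is even by alternation. A repeated letter in
  -- `x` gives a shorter gap. Otherwise `x` is empty, or its first two letters are singletons of the
  -- whole word, because noncrossing confines them to the gap.
  have key : ∀ n u a x z, x.length = n → w = u ++ a :: (x ++ a :: z) →
      ∃ u s t v, w = u ++ s :: t :: v ∧ (s = t ∨ (s ≠ t ∧ s ∉ u ++ v ∧ t ∉ u ++ v)) := by
    intro n
    induction n using Nat.strong_induction_on with
    | _ n ih =>
      intro u a x z hn hsplit
      obtain ⟨hau, hax, haz⟩ := notMem_of_count_le_two (hsplit ▸ (halt.2 a).1)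
      have hcount : w.count a = 2 := by
        rw [hsplit]
        simp [List.count_append, List.count_eq_zero_of_not_mem hau,
          List.count_eq_zero_of_not_mem hax, List.count_eq_zero_of_not_mem haz]
      have heven : Even x.length :=
        (signedCount_split hau hax haz).1 (hsplit ▸ (halt.2 a).2 hcount)
      have hdisj := nc_between_disjoint (hsplit ▸ hnc) hax
      by_cases hnd : x.Nodup
      · match x with
        | [] => exact ⟨u, a, a, z, by simpa using hsplit, Or.inl rfl⟩
        | [s] => simp at heven
        | s :: t :: x =>
          have hs := hdisj s (by simp)
          have ht := hdisj t (by simp)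
          simp only [List.nodup_cons, List.mem_cons, not_or] at hnd hax
          refine ⟨u ++ [a], s, t, x ++ a :: z, by simpa using hsplit, Or.inr ⟨hnd.1.1, ?_, ?_⟩⟩
          · simp [hs, hnd, Ne.symm hax.1]
          · simp [ht, hnd, Ne.symm hax.2.1]
      · obtain ⟨b, hb⟩ := List.exists_duplicate_iff_not_nodup.2 hnd
        have hb2 : 2 ≤ x.count b := List.duplicate_iff_two_le_count.1 hb
        obtain ⟨x1, x2, x3, rfl, -, -⟩ := exists_split_of_two_le_count hb2
        refine ih x2.length ?_ (u ++ a :: x1) b x2 (x3 ++ a :: z) rfl (by simpa using hsplit)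
        subst hn
        simp
        omega
  by_cases hnd : w.Nodup
  · match w with
    | [] => exact absurd rfl hw
    | [s] => exact absurd halt.1 (by simp)
    | s :: t :: x =>
      simp only [List.nodup_cons, List.mem_cons, not_or] at hnd
      exact ⟨[], s, t, x, rfl, Or.inr ⟨hnd.1.1, by simp [hnd], by simp [hnd]⟩⟩
  · obtain ⟨b, hb⟩ := List.exists_duplicate_iff_not_nodup.2 hnd
    have hb2 : 2 ≤ w.count b := List.duplicate_iff_two_le_count.1 hb
    obtain ⟨x1, x2, x3, hs, -, -⟩ := exists_split_of_two_le_count hb2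
    exact key _ x1 b x2 x3 rfl hs

/-- Deleting two neighbours shifts later positions by two, preserving all signs, and a letter still
occurring twice cannot be `s` or `t`. -/
theorem altWords_remove {u v : List ℕ} {s t : ℕ} (h : u ++ s :: t :: v ∈ altWords)
    (hst : s = t ∨ (s ≠ t ∧ s ∉ u ++ v ∧ t ∉ u ++ v)) : u ++ v ∈ altWords := by
  refine ⟨?_, fun x => ?_⟩
  · have := h.1
    simp only [List.length_append, List.length_cons] at this ⊢
    rw [Nat.even_iff] at *
    omega
  · have hx := h.2 x
    rw [List.count_append, signedCount_append] at hx ⊢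
    simp only [List.count_cons, signedCount, beq_iff_eq] at hx
    refine ⟨by omega, fun h2 => ?_⟩
    have hxs : s ≠ x := by
      rintro rfl
      rcases hst with rfl | ⟨-, h3, -⟩
      · simp at hx; omega
      · rw [← List.count_append, List.count_eq_zero_of_not_mem h3] at h2; omega
    have hxt : t ≠ x := by
      rintro rfl
      rcases hst with rfl | ⟨-, -, h3⟩
      · exact hxs rfl
      · rw [← List.count_append, List.count_eq_zero_of_not_mem h3] at h2; omega
    simp only [hxs, hxt, if_false] at hx
    have := hx.2 (by omega)
    linarith

namespace IsWordCategory

variable {L : Set (List ℕ)}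

theorem nc_inter_alt_subset (h : IsWordCategory L) (hs : [0, 1] ∈ L) :
    ncWords ∩ altWords ⊆ L := by
  rintro w ⟨hnc, halt⟩
  induction hn : w.length using Nat.strong_induction_on generalizing w with
  | _ n ih =>
    by_cases hw : w = []
    · rw [hw]; exact h.nil_mem
    obtain ⟨u, s, t, v, rfl, hst⟩ := exists_removable hnc halt hw
    have h1 : u ++ v ∈ L := by
      refine ih _ ?_ (ncWords_of_sublist hnc ?_) (altWords_remove halt hst) rfl
      · subst hn; simp
      · exact (List.Sublist.refl u).append ((List.sublist_cons_self t v).trans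
          (List.sublist_cons_self s _))
    rcases hst with rfl | ⟨h2, h3, h4⟩
    · have hcount := (halt.2 s).1
      simp only [List.count_append, List.count_cons_self] at hcount
      have hsu : s ∉ u := by rw [← List.count_eq_zero]; omega
      have hsv : s ∉ v := by rw [← List.count_eq_zero]; omega
      simpa using h.insert h1 (h.pair_mem s) (by simpa using hsu) (by simpa using hsv)
    · simp only [List.mem_append, not_or] at h3 h4
      simpa using h.insert h1 (h.recolor_two hs h2) (by simp [h3, h4]) (by simp [h3, h4])

/-! ### Extraction of generators from given words. -/

/-- A factor whose letters do not occur elsewhere can be capped to length at most one. -/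
theorem collapse (h : IsWordCategory L) {u y v : List ℕ} (hw : u ++ y ++ v ∈ L)
    (hd : ∀ x ∈ y, x ∉ u ∧ x ∉ v) :
    (Even y.length → u ++ v ∈ L) ∧ (Odd y.length → ∃ t, t ∉ u ∧ t ∉ v ∧ u ++ t :: v ∈ L) := by
  induction hn : y.length using Nat.strong_induction_on generalizing y with
  | _ n ih =>
    match y with
    | [] => subst hn; exact ⟨fun _ => by simpa using hw, by simp⟩
    | [t] =>
      subst hn
      exact ⟨by simp, fun _ => ⟨t, (hd t (by simp)).1, (hd t (by simp)).2, by simpa using hw⟩⟩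
    | c :: d :: y =>
      have hdd := hd d (by simp)
      -- The cap merges letters of the factor only, so `u` and `v` stay untouched and the factor
      -- stays disjoint from them.
      have h1 := h.cap_mid (u := u) (a := c) (b := d) (v := y ++ v) (by simpa using hw)
      rw [List.map_append, List.map_append, map_merge_of_notMem hdd.1, map_merge_of_notMem hdd.2,
        ← List.append_assoc] at h1
      have := ih (y.map (merge c d)).length (by subst hn; simp) h1 (by
        intro x hx
        obtain ⟨z, hz, rfl⟩ := List.mem_map.1 hx
        unfold merge
        split_ifs
        · exact hd c (by simp)
        · exact hd z (by simp [hz])) rfl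
      subst hn
      simp only [List.length_map] at this
      simpa [Nat.even_add_one, Nat.odd_add_one] using this

theorem singleton_mem_of_odd (h : IsWordCategory L) {w : List ℕ} (hw : w ∈ L) (ho : Odd w.length) :
    [0] ∈ L := by
  obtain ⟨t, -, -, ht⟩ := (h.collapse (u := []) (v := []) (y := w) (by simpa using hw) (by simp)).2 ho
  exact h.recolor_const (n := 1) (a := t) ht 0

/-- The word without `s` has odd length and does not involve `s`, so it collapses to one further
singleton. -/
theorem doubleton_mem_of_count_eq_one (h : IsWordCategory L) (he : L ⊆ evenWords) {w : List ℕ}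
    (hw : w ∈ L) {s : ℕ} (hs : w.count s = 1) : [0, 1] ∈ L := by
  obtain ⟨u, v, rfl⟩ := List.append_of_mem (List.count_pos_iff.1 (show 0 < w.count s by omega))
  have hsv : s ∉ v ++ u := by
    rw [← List.count_eq_zero]
    simp only [List.count_append, List.count_cons_self] at hs ⊢
    omega
  have h1 : [s] ++ (v ++ u) ++ [] ∈ L := by simpa using h.append_comm hw
  have hodd : Odd (v ++ u).length := by
    have := he h1
    simp only [evenWords, Set.mem_ofPred_eq, List.append_nil, List.length_append] at this ⊢
    rw [Nat.even_iff] at this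
    rw [Nat.odd_iff]
    simp at this
    omega
  obtain ⟨t, ht, -, h2⟩ := (h.collapse h1 (by
    intro x hx
    refine ⟨?_, by simp⟩
    rintro hxs
    rw [List.mem_singleton.1 hxs] at hx
    exact hsv hx)).2 hodd
  have hts : t ≠ s := by simpa using ht
  have := h.recolor (φ := fun n => if n = s then 0 else 1) h2 (by
    intro x hx y hy hxy
    simp only [List.cons_append, List.nil_append, List.mem_cons, List.not_mem_nil, or_false,
      Set.mem_ofPred_eq] at hx hy
    rcases hx with rfl | rfl <;> rcases hy with rfl | rfl <;> simp_all)
  simpa [hts] using this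

/-- Gluing a word to its mirror image along a factor. -/
theorem mirror (h : IsWordCategory L) {y z : List ℕ} {N : ℕ} (hN : ∀ x ∈ y ++ z, x < N)
    (hw : y ++ z ∈ L) :
    (y ++ (y.map (· + N)).reverse).map
      (fun x => if x < N then x else if x - N ∈ z then x - N else x) ∈ L := by
  have h1 := h.reverse (h.recolor (φ := (· + N)) hw (fun x _ y _ hxy => by simpa using hxy))
  have h2 := h.append hw h1 (by
    intro x hx hx'
    have := hN x hx
    rw [List.mem_reverse, List.mem_map] at hx'
    obtain ⟨y, -, rfl⟩ := hx'
    omega)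
  -- The word and its mirror image together read `y z z' y'`, with the copies `z'`, `y'` reversed,
  -- and the middle is contracted. The coequalizer sends the copy `x + N` of a letter of `z` back to
  -- `x`; letters of `y` outside `z` stay distinct from their copies.
  refine h.contract (x := z) (x' := z.map (· + N)) (u := y) (by simpa using h2) (by simp) ?_ ?_
  · rw [List.map_map]
    refine List.map_congr_left fun x hx => ?_
    have := hN x (by simp [hx])
    simp [this, hx]
  · intro d hd s hs t ht hst
    have hdz : ∀ x ∈ z, d x = d (x + N) := by
      rw [List.map_map] at hd
      exact List.map_inj_left.1 hd
    have hdc : ∀ x, d (if x < N then x else if x - N ∈ z then x - N else x) = d x := by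
      intro x
      split_ifs with h3 h4
      · rfl
      · rw [hdz _ h4, Nat.sub_add_cancel (by omega)]
      · rfl
    rw [← hdc s, ← hdc t, hst]

/-- Mirror along `[a, a]`: since `a` also occurs in the glued part, the two copies of the pair join
to a four block. -/
theorem four_mem_of_adjacent (h : IsWordCategory L) {a : ℕ} {z : List ℕ} (hw : a :: a :: z ∈ L)
    (ha : a ∈ z) : replicate 4 0 ∈ L := by
  obtain ⟨N, hN⟩ := exists_fresh (a :: a :: z)
  have h1 := h.mirror (y := [a, a]) (z := z) hN hw
  have haN := hN a (by simp)
  have h2 : replicate 4 a ∈ L := by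
    simpa [haN, ha, List.replicate] using h1
  exact h.recolor_const h2 0

/-- Collapse the gap between two occurrences of `a`. If nothing remains, `four_mem_of_adjacent`
applies. If a singleton `t` remains, mirroring along `a t a` gives `a t a a t' a`, in which two
neighbouring `a` appear alongside others. -/
theorem four_mem_of_count (h : IsWordCategory L) (hnc : L ⊆ ncWords) {a : ℕ} {w : List ℕ}
    (hw : w ∈ L) (ha : 3 ≤ w.count a) : replicate 4 0 ∈ L := by
  obtain ⟨u, x, z, rfl, hu, hx⟩ := exists_split_of_two_le_count (show 2 ≤ w.count a by omega)
  have haz : a ∈ z := by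
    rw [← List.count_pos_iff]
    simp only [List.count_append, List.count_cons_self, List.count_eq_zero_of_not_mem hu,
      List.count_eq_zero_of_not_mem hx] at ha
    omega
  have h1 : [a] ++ x ++ a :: (z ++ u) ∈ L := by simpa using h.append_comm hw
  have hdisj := nc_between_disjoint (u := []) (by simpa using hnc h1) hx
  have hcol := h.collapse h1 (by
    intro y hy
    have hya : y ≠ a := by rintro rfl; exact hx hy
    have := (hdisj y hy).2
    simp only [List.mem_append, not_or] at this
    simp [hya, this])
  rcases Nat.even_or_odd x.length with he | ho
  · exact h.four_mem_of_adjacent (hcol.1 he) (by simp [haz])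
  · obtain ⟨t, ht, ht', h2⟩ := hcol.2 ho
    have hta : t ≠ a := by simpa using ht
    simp only [List.mem_cons, List.mem_append, not_or] at ht'
    obtain ⟨N, hN⟩ := exists_fresh (a :: t :: a :: (z ++ u))
    have h3 := h.mirror (y := [a, t, a]) (z := z ++ u) hN h2
    have haN := hN a (by simp)
    have htN := hN t (by simp)
    have h4 : [a, t] ++ [a, a, t + N, a] ∈ L := by
      simpa [haN, haz, htN, ht'] using h3
    exact h.four_mem_of_adjacent (h.append_comm h4) (by simp)

/-- Collapse the gap between two occurrences of `a`: an odd gap leaves a singleton and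
`doubleton_mem_of_count_eq_one` applies; after an even gap, capping the two `a` lowers the count by
two and keeps it odd. -/
theorem doubleton_mem_of_odd_count (h : IsWordCategory L) (hnc : L ⊆ ncWords)
    (he : L ⊆ evenWords) {a : ℕ} {w : List ℕ} (hw : w ∈ L) (ha : Odd (w.count a)) :
    [0, 1] ∈ L := by
  induction hn : w.count a using Nat.strong_induction_on generalizing w with
  | _ n ih =>
    by_cases h1 : w.count a = 1
    · exact h.doubleton_mem_of_count_eq_one he hw h1
    have h3 : 3 ≤ w.count a := by
      obtain ⟨k, hk⟩ := ha
      omega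
    obtain ⟨u, x, z, rfl, hu, hx⟩ := exists_split_of_two_le_count (show 2 ≤ w.count a by omega)
    have h1 : [a] ++ x ++ a :: (z ++ u) ∈ L := by simpa using h.append_comm hw
    have hdisj := nc_between_disjoint (u := []) (by simpa using hnc h1) hx
    have hcol := h.collapse h1 (by
      intro y hy
      have hya : y ≠ a := by rintro rfl; exact hx hy
      have := (hdisj y hy).2
      simp only [List.mem_append, not_or] at this
      simp [hya, this])
    rcases Nat.even_or_odd x.length with hev | ho
    · have h4 := h.cap_self (u := []) (hcol.1 hev)
      have hcount : (u ++ a :: (x ++ a :: z)).count a = ([] ++ (z ++ u)).count a + 2 := by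
        simp [List.count_append, List.count_eq_zero_of_not_mem hx]
        omega
      refine ih _ (by omega) h4 ?_ rfl
      rw [hcount] at ha
      rw [Nat.odd_iff] at ha ⊢
      omega
    · obtain ⟨t, ht, ht', h2⟩ := hcol.2 ho
      refine h.doubleton_mem_of_count_eq_one he h2 (s := t) ?_
      rw [List.count_append, List.count_eq_zero_of_not_mem ht, List.count_cons_self,
        List.count_eq_zero_of_not_mem ht']

/-- A pair of equal parity has a gap of odd length, and the rest of the cyclic word is then odd too.
Both collapse to singletons, leaving `a t a s`. -/
theorem positioner_mem_of_not_alt (h : IsWordCategory L) (hnc : L ⊆ ncWords) (he : L ⊆ evenWords)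
    (hc : L ⊆ countWords {1, 2}) {w : List ℕ} (hw : w ∈ L) (hw' : w ∉ altWords) :
    [1, 2, 3, 2] ∈ L := by
  have hle : ∀ x, w.count x ≤ 2 := by
    intro x
    by_cases hx : x ∈ w
    · rcases hc hw x hx with h | h <;> simp_all
    · rw [List.count_eq_zero_of_not_mem hx]; omega
  obtain ⟨a, ha2, ha⟩ : ∃ a, w.count a = 2 ∧ signedCount a w ≠ 0 := by
    by_contra hcon
    push Not at hcon
    exact hw' ⟨he hw, fun x => ⟨hle x, hcon x⟩⟩
  obtain ⟨u, x, z, rfl, hu, hx⟩ := exists_split_of_two_le_count ha2.ge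
  have haz := (notMem_of_count_le_two ha2.le).2.2
  rw [Ne, signedCount_split hu hx haz, Nat.not_even_iff_odd] at ha
  have h1 : [a] ++ x ++ a :: (z ++ u) ∈ L := by simpa using h.append_comm hw
  have hdisj := nc_between_disjoint (u := []) (by simpa using hnc h1) hx
  obtain ⟨t, ht, ht', h2⟩ := (h.collapse h1 (by
    intro y hy
    have hya : y ≠ a := by rintro rfl; exact hx hy
    have := (hdisj y hy).2
    simp only [List.mem_append, not_or] at this
    simp [hya, this])).2 ha
  simp only [List.mem_cons, List.mem_append, not_or, List.not_mem_nil, not_false_eq_true,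
    and_true] at ht ht'
  obtain ⟨s, hs, -, h3⟩ := (h.collapse (u := [a, t, a]) (y := z ++ u) (v := [])
    (by simpa using h2) (by
      intro y hy
      have hya : y ≠ a := by rintro rfl; simp [haz, hu] at hy
      have hyt : y ≠ t := by rintro rfl; simp [ht'] at hy
      simp [hya, hyt])).2 (by
        have := he h2
        simp only [evenWords, Set.mem_ofPred_eq, List.length_append, List.length_cons,
          List.length_nil] at this ⊢
        rw [Nat.even_iff] at this
        rw [Nat.odd_iff]
        omega)
  simp only [List.mem_cons, not_or] at hs
  have h4 : [t, a, s, a] ∈ L := h.rotate h3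
  have h5 := h.recolor (φ := fun n => if n = t then 1 else if n = a then 2 else 3) h4 (by
    intro x hx y hy hxy
    simp only [List.mem_cons, List.not_mem_nil, or_false,
      Set.mem_ofPred_eq] at hx hy
    rcases hx with rfl | rfl | rfl | rfl <;> rcases hy with rfl | rfl | rfl | rfl <;>
      simp_all [eq_comm])
  simpa [hs, ht, Ne.symm ht] using h5

end IsWordCategory

/-! ### The dictionary between partitions and words. -/

/-- The word of colors of a colored pair of rows, read along the upper row from right to left and
then along the lower row from left to right. -/
def word {k l : ℕ} (f : Fin k ⊕ Fin l → ℕ) : List ℕ :=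
  (ofFn (f ∘ Sum.inl)).reverse ++ ofFn (f ∘ Sum.inr)

theorem mem_word {k l : ℕ} {f : Fin k ⊕ Fin l → ℕ} {c : ℕ} : c ∈ word f ↔ ∃ x, f x = c := by
  simp [word, List.mem_ofFn]

theorem word_comp {k l : ℕ} (φ : ℕ → ℕ) (f : Fin k ⊕ Fin l → ℕ) :
    word (φ ∘ f) = (word f).map φ := by
  simp [word, List.map_ofFn, Function.comp_assoc]

theorem length_word {k l : ℕ} (f : Fin k ⊕ Fin l → ℕ) : (word f).length = k + l := by
  simp [word]

theorem exists_factor {α : Type*} {f g : α → ℕ} (h : ∀ x y, f x = f y → g x = g y) :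
    ∃ φ : ℕ → ℕ, ∀ x, φ (f x) = g x :=
  ⟨Function.extend f g id, fun x => Function.FactorsThrough.extend_apply (fun _ _ e => h _ _ e) id x⟩

theorem exists_coloring {α : Type*} [Finite α] (p : Setoid α) : ∃ f : α → ℕ, Setoid.ker f = p := by
  obtain ⟨g, hg⟩ := Countable.exists_injective_nat (Quotient p)
  refine ⟨g ∘ Quotient.mk p, Setoid.ext fun x y => ?_⟩
  rw [Setoid.ker_def, Function.comp, Function.comp, hg.eq_iff]
  exact Quotient.eq

theorem top_eq_ker {α : Type*} (c : ℕ) : (⊤ : Setoid α) = Setoid.ker (fun _ => c) :=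
  Setoid.ext fun _ _ => ⟨fun _ => rfl, fun _ => trivial⟩

theorem map_rel {α β : Type*} {p : Setoid α} {φ : α → β} {x y : α} (h : p x y) :
    Setoid.map p φ (φ x) (φ y) := Relation.EqvGen.rel _ _ ⟨x, y, h, rfl, rfl⟩

theorem map_le {α β : Type*} {p : Setoid α} {φ : α → β} {q : Setoid β}
    (h : ∀ x y, p x y → q (φ x) (φ y)) : Setoid.map p φ ≤ q := by
  intro a b hab
  induction hab with
  | rel _ _ h' => obtain ⟨x, y, hxy, rfl, rfl⟩ := h'; exact h x y hxy
  | refl => exact q.refl _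
  | symm _ _ _ ih => exact q.symm ih
  | trans _ _ _ _ _ ih ih' => exact q.trans ih ih'

theorem tensor_ker {k l k' l' : ℕ} (f : Fin k ⊕ Fin l → ℕ) (g : Fin k' ⊕ Fin l' → ℕ)
    (hd : ∀ x y, f x ≠ g y) :
    tensor (Setoid.ker f) (Setoid.ker g) =
      Setoid.ker (Sum.elim (Fin.append (f ∘ Sum.inl) (g ∘ Sum.inl))
        (Fin.append (f ∘ Sum.inr) (g ∘ Sum.inr))) := by
  set h : Fin (k + k') ⊕ Fin (l + l') → ℕ := Sum.elim (Fin.append (f ∘ Sum.inl) (g ∘ Sum.inl))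
        (Fin.append (f ∘ Sum.inr) (g ∘ Sum.inr)) with hh
  have h1 : ∀ x, h (Sum.map (Fin.castAdd k') (Fin.castAdd l') x) = f x := by
    rintro (x | x) <;> simp [hh]
  have h2 : ∀ x, h (Sum.map (Fin.natAdd k) (Fin.natAdd l) x) = g x := by
    rintro (x | x) <;> simp [hh]
  have hcov : ∀ z, (∃ x, z = Sum.map (Fin.castAdd k') (Fin.castAdd l') x) ∨
      ∃ x, z = Sum.map (Fin.natAdd k) (Fin.natAdd l) x := by
    rintro (z | z)
    · refine Fin.addCases (fun i => ?_) (fun i => ?_) z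
      · exact Or.inl ⟨Sum.inl i, rfl⟩
      · exact Or.inr ⟨Sum.inl i, rfl⟩
    · refine Fin.addCases (fun i => ?_) (fun i => ?_) z
      · exact Or.inl ⟨Sum.inr i, rfl⟩
      · exact Or.inr ⟨Sum.inr i, rfl⟩
  refine le_antisymm (sup_le (map_le fun x y hxy => ?_) (map_le fun x y hxy => ?_)) ?_
  · rw [Setoid.ker_def] at hxy ⊢
    rw [h1, h1, hxy]
  · rw [Setoid.ker_def] at hxy ⊢
    rw [h2, h2, hxy]
  · intro a b hab
    have hab' : h a = h b := hab
    rcases hcov a with ⟨x, rfl⟩ | ⟨x, rfl⟩ <;> rcases hcov b with ⟨y, rfl⟩ | ⟨y, rfl⟩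
    · rw [h1, h1] at hab'
      exact (le_sup_left : _ ≤ tensor (Setoid.ker f) (Setoid.ker g)) (map_rel hab')
    · rw [h1, h2] at hab'
      exact absurd hab' (hd _ _)
    · rw [h1, h2] at hab'
      exact absurd hab'.symm (hd _ _)
    · rw [h2, h2] at hab'
      exact (le_sup_right : _ ≤ tensor (Setoid.ker f) (Setoid.ker g)) (map_rel hab')

/-- The composition of two partitions is given by a coequalizer of the colors of the middle
points. -/
theorem comp_ker {k l m : ℕ} (f : Fin k ⊕ Fin l → ℕ) (g : Fin l ⊕ Fin m → ℕ)
    (hd : ∀ x y, f x ≠ g y) (c : ℕ → ℕ) (hc : ∀ j, c (f (Sum.inr j)) = c (g (Sum.inl j)))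
    (huniv : ∀ d : ℕ → ℕ, (∀ j, d (f (Sum.inr j)) = d (g (Sum.inl j))) →
      ∀ s t, c s = c t → d s = d t) :
    comp (Setoid.ker f) (Setoid.ker g) =
      Setoid.ker (c ∘ (Sum.elim (f ∘ Sum.inl) (g ∘ Sum.inr) : Fin k ⊕ Fin m → ℕ)) := by
  set S : Setoid (Fin k ⊕ (Fin l ⊕ Fin m)) :=
    Setoid.map (Setoid.ker f) (Sum.map id Sum.inl) ⊔ Setoid.map (Setoid.ker g) Sum.inr with hS
  have hle1 : Setoid.map (Setoid.ker f) (Sum.map id Sum.inl) ≤ S := le_sup_left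
  have hle2 : Setoid.map (Setoid.ker g) Sum.inr ≤ S := le_sup_right
  let F : Fin k ⊕ (Fin l ⊕ Fin m) → ℕ := Sum.elim (c ∘ f ∘ Sum.inl) (c ∘ g)
  have hF : ∀ x, F (Sum.map id Sum.inl x) = c (f x) := by
    rintro (x | x)
    · rfl
    · exact (hc x).symm
  have hSF : S ≤ Setoid.ker F := by
    refine sup_le (map_le fun x y hxy => ?_) (map_le fun x y hxy => ?_)
    · rw [Setoid.ker_def] at hxy ⊢
      rw [hF, hF, hxy]
    · rw [Setoid.ker_def] at hxy ⊢
      exact congrArg c hxy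
  -- For the converse, colour the generated relation itself by `G`. Since `f` and `g` share no
  -- colours, `G` factors through a single recolouring `d`, to which the universal property of `c`
  -- applies.
  obtain ⟨G, hG⟩ := exists_coloring S
  have hGf : ∀ x y, f x = f y → G (Sum.map id Sum.inl x) = G (Sum.map id Sum.inl y) := by
    intro x y hxy
    have : S (Sum.map id Sum.inl x) (Sum.map id Sum.inl y) := hle1 (map_rel hxy)
    rwa [← hG] at this
  have hGg : ∀ x y, g x = g y → G (Sum.inr x) = G (Sum.inr y) := by
    intro x y hxy
    have : S (Sum.inr x) (Sum.inr y) := hle2 (map_rel hxy)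
    rwa [← hG] at this
  obtain ⟨d, hdd⟩ := exists_factor (f := Sum.elim f g)
    (g := Sum.elim (fun x => G (Sum.map id Sum.inl x)) (fun y => G (Sum.inr y))) (by
      rintro (x | x) (y | y) hxy
      · exact hGf x y hxy
      · exact absurd hxy (hd x y)
      · exact absurd hxy.symm (hd y x)
      · exact hGg x y hxy)
  have hdf : ∀ x, d (f x) = G (Sum.map id Sum.inl x) := fun x => hdd (Sum.inl x)
  have hdg : ∀ y, d (g y) = G (Sum.inr y) := fun y => hdd (Sum.inr y)
  have hu := huniv d fun j => by rw [hdf, hdg]; rfl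
  have hd' : ∀ z : Fin k ⊕ Fin m, d (Sum.elim (f ∘ Sum.inl) (g ∘ Sum.inr) z) =
      G (Sum.map id Sum.inr z) := by
    rintro (z | z)
    · exact hdf _
    · exact hdg _
  have hF' : ∀ z : Fin k ⊕ Fin m, F (Sum.map id Sum.inr z) =
      c (Sum.elim (f ∘ Sum.inl) (g ∘ Sum.inr) z) := by
    rintro (z | z) <;> rfl
  refine Setoid.ext fun x y => ⟨fun hxy => ?_, fun hxy => ?_⟩
  · have : F (Sum.map id Sum.inr x) = F (Sum.map id Sum.inr y) := hSF hxy
    rwa [hF', hF'] at this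
  · have := hu _ _ hxy
    rw [hd', hd'] at this
    have h3 : S (Sum.map id Sum.inr x) (Sum.map id Sum.inr y) := by rw [← hG]; exact this
    exact h3

theorem exists_coequalizer {ι : Type*} (a b : ι → ℕ) : ∃ c : ℕ → ℕ, (∀ j, c (a j) = c (b j)) ∧
    ∀ d : ℕ → ℕ, (∀ j, d (a j) = d (b j)) → ∀ s t, c s = c t → d s = d t := by
  let r : Setoid ℕ := Relation.EqvGen.setoid fun s t => ∃ j, s = a j ∧ t = b j
  refine ⟨fun n => (Quotient.mk r n).out, fun j => ?_, fun d hd s t hst => ?_⟩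
  · have : Quotient.mk r (a j) = Quotient.mk r (b j) :=
      Quotient.sound (Relation.EqvGen.rel _ _ ⟨j, rfl, rfl⟩)
    simp only [this]
  · have h1 : Quotient.mk r s = Quotient.mk r t := by
      have := congrArg (Quotient.mk r) hst
      simpa using this
    have h2 : Relation.EqvGen (fun s t => ∃ j, s = a j ∧ t = b j) s t := Quotient.exact h1
    clear hst h1
    induction h2 with
    | rel _ _ h => obtain ⟨j, rfl, rfl⟩ := h; exact hd j
    | refl => rfl
    | symm _ _ _ ih => exact ih.symm
    | trans _ _ _ _ _ ih ih' => exact ih.trans ih'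

/-- The map on points underlying the left rotation. -/
def leftMap (k l : ℕ) : Fin k ⊕ Fin (l + 1) → Fin (k + 1) ⊕ Fin l :=
  Sum.elim (fun i : Fin k => Sum.inl i.succ)
      (Fin.cons (Sum.inl 0) Sum.inr : Fin (l + 1) → Fin (k + 1) ⊕ Fin l)

/-- The map on points underlying the right rotation. -/
def rightMap (k l : ℕ) : Fin k ⊕ Fin (l + 1) → Fin (k + 1) ⊕ Fin l :=
  Sum.elim (fun i : Fin k => Sum.inl i.castSucc)
      (Fin.snoc Sum.inr (Sum.inl (Fin.last k)) : Fin (l + 1) → Fin (k + 1) ⊕ Fin l)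

theorem rotateLeft_ker {k l : ℕ} (f : Fin (k + 1) ⊕ Fin l → ℕ) :
    rotateLeft (Setoid.ker f) = Setoid.ker (f ∘ leftMap k l) := rfl

theorem rotateRight_ker {k l : ℕ} (f : Fin (k + 1) ⊕ Fin l → ℕ) :
    rotateRight (Setoid.ker f) = Setoid.ker (f ∘ rightMap k l) := rfl

theorem involution_ker {k l : ℕ} (f : Fin k ⊕ Fin l → ℕ) :
    involution (Setoid.ker f) = Setoid.ker (f ∘ Sum.swap) := rfl

theorem word_leftMap {k l : ℕ} (f : Fin (k + 1) ⊕ Fin l → ℕ) : word (f ∘ leftMap k l) = word f := by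
  unfold word
  rw [List.ofFn_succ (f := f ∘ Sum.inl), List.ofFn_succ (f := (f ∘ leftMap k l) ∘ Sum.inr)]
  rw [List.reverse_cons, List.append_assoc]
  rfl

theorem word_rightMap {k l : ℕ} (f : Fin (k + 1) ⊕ Fin l → ℕ) :
    ∃ w, word f = f (Sum.inl (Fin.last k)) :: w ∧
      word (f ∘ rightMap k l) = w ++ [f (Sum.inl (Fin.last k))] := by
  refine ⟨word (f ∘ Sum.map Fin.castSucc id), ?_, ?_⟩
  · unfold word
    rw [List.ofFn_succ' (f := f ∘ Sum.inl), List.concat_eq_append, List.reverse_append]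
    rfl
  · unfold word
    rw [List.ofFn_succ' (f := (f ∘ rightMap k l) ∘ Sum.inr), List.concat_eq_append,
      ← List.append_assoc]
    simp only [Function.comp_def, rightMap, Sum.elim_inr, Fin.snoc_castSucc, Fin.snoc_last,
      Sum.elim_inl, Sum.map_inl, Sum.map_inr, id]

theorem word_swap {k l : ℕ} (f : Fin k ⊕ Fin l → ℕ) : word (f ∘ Sum.swap) = (word f).reverse := by
  simp [word, Function.comp_def]

/-- The collection of partitions encoded by a set of words. -/
def ofWords (L : Set (List ℕ)) : Collection := fun _ _ =>
  {p | ∃ f, Setoid.ker f = p ∧ word f ∈ L}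

/-- The set of words encoding the one-row partitions of a collection. -/
def toWords (X : Collection) : Set (List ℕ) :=
  {w | Setoid.ker (Sum.elim Fin.elim0 w.get : Fin 0 ⊕ Fin w.length → ℕ) ∈ X 0 w.length}

/-- Two colourings with the same kernel differ by a renaming injective on the letters in use, so
membership does not depend on the choice of colouring. -/
theorem ker_mem_ofWords {L : Set (List ℕ)} (h : IsWordCategory L) {k l : ℕ}
    {f : Fin k ⊕ Fin l → ℕ} : Setoid.ker f ∈ ofWords L k l ↔ word f ∈ L := by
  refine ⟨?_, fun hf => ⟨f, rfl, hf⟩⟩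
  rintro ⟨g, hg, hgL⟩
  have hfg : ∀ x y, g x = g y ↔ f x = f y := fun x y => by
    rw [← Setoid.ker_def, ← Setoid.ker_def, hg]
  obtain ⟨φ, hφ⟩ := exists_factor fun x y => (hfg x y).1
  have : word f = (word g).map φ := by
    rw [← word_comp]
    congr 1
    funext x
    exact (hφ x).symm
  rw [this]
  refine h.recolor hgL ?_
  intro s hs t ht hst
  obtain ⟨x, rfl⟩ := mem_word.1 hs
  obtain ⟨y, rfl⟩ := mem_word.1 ht
  rw [hφ, hφ] at hst
  exact (hfg x y).2 hst

theorem ofWords_mono {L L' : Set (List ℕ)} (h : L ⊆ L') (k l : ℕ) :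
    ofWords L k l ⊆ ofWords L' k l := by
  rintro p ⟨f, hf, hfL⟩
  exact ⟨f, hf, h hfL⟩

theorem isCategory_ofWords {L : Set (List ℕ)} (h : IsWordCategory L) : IsCategory (ofWords L) where
  tensor_mem := by
    rintro k l k' l' _ _ ⟨f, rfl, hf⟩ ⟨g, rfl, hg⟩
    -- Even colours for one factor and odd colours for the other make the letters disjoint.
    have hf' : word ((fun n => 2 * n) ∘ f) ∈ L := by
      rw [word_comp]; exact h.recolor hf fun x _ y _ hxy => by simpa using hxy
    have hg' : word ((fun n => 2 * n + 1) ∘ g) ∈ L := by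
      rw [word_comp]; exact h.recolor hg fun x _ y _ hxy => by simpa using hxy
    have ef : Setoid.ker f = Setoid.ker ((fun n => 2 * n) ∘ f) :=
      Setoid.ext fun x y => by simp [Setoid.ker_def]
    have eg : Setoid.ker g = Setoid.ker ((fun n => 2 * n + 1) ∘ g) :=
      Setoid.ext fun x y => by simp [Setoid.ker_def]
    have hd : ∀ x y, ((fun n => 2 * n) ∘ f) x ≠ ((fun n => 2 * n + 1) ∘ g) y := by
      intro x y; simp only [Function.comp]; omega
    rw [ef, eg]
    generalize (fun n => 2 * n) ∘ f = f' at *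
    generalize (fun n => 2 * n + 1) ∘ g = g' at *
    rw [tensor_ker f' g' hd]
    refine ⟨_, rfl, ?_⟩
    have key : ∀ y ∈ word f', y ∉ word g' := by
      intro y hy hy'
      obtain ⟨a, rfl⟩ := mem_word.1 hy
      obtain ⟨b, hb⟩ := mem_word.1 hy'
      exact hd a b hb.symm
    -- In counterclockwise order the left factor sits between the upper and the lower row of the
    -- right factor.
    have := h.insert (u := (ofFn (g' ∘ Sum.inl)).reverse) (v := ofFn (g' ∘ Sum.inr)) hg' hf'
      (fun y hy hy' => key y hy (List.mem_append_left _ hy'))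
      (fun y hy hy' => key y hy (List.mem_append_right _ hy'))
    simpa [word, Sum.elim_comp_inl, Sum.elim_comp_inr, List.ofFn_fin_append] using this
  comp_mem := by
    rintro k l m _ _ ⟨f, rfl, hf⟩ ⟨g, rfl, hg⟩
    have hf' : word ((fun n => 2 * n) ∘ f) ∈ L := by
      rw [word_comp]; exact h.recolor hf fun x _ y _ hxy => by simpa using hxy
    have hg' : word ((fun n => 2 * n + 1) ∘ g) ∈ L := by
      rw [word_comp]; exact h.recolor hg fun x _ y _ hxy => by simpa using hxy
    have ef : Setoid.ker f = Setoid.ker ((fun n => 2 * n) ∘ f) :=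
      Setoid.ext fun x y => by simp [Setoid.ker_def]
    have eg : Setoid.ker g = Setoid.ker ((fun n => 2 * n + 1) ∘ g) :=
      Setoid.ext fun x y => by simp [Setoid.ker_def]
    have hd : ∀ x y, ((fun n => 2 * n) ∘ f) x ≠ ((fun n => 2 * n + 1) ∘ g) y := by
      intro x y; simp only [Function.comp]; omega
    rw [ef, eg]
    generalize (fun n => 2 * n) ∘ f = f' at *
    generalize (fun n => 2 * n + 1) ∘ g = g' at *
    obtain ⟨c, hc, huniv⟩ := exists_coequalizer (fun j => f' (Sum.inr j)) (fun j => g' (Sum.inl j))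
    rw [comp_ker f' g' hd c hc huniv]
    refine ⟨_, rfl, ?_⟩
    have key : ∀ y ∈ word f', y ∉ word g' := by
      intro y hy hy'
      obtain ⟨a, rfl⟩ := mem_word.1 hy
      obtain ⟨b, hb⟩ := mem_word.1 hy'
      exact hd a b hb.symm
    have h1 := h.append hf' hg' key
    rw [word_comp]
    refine h.contract (x := ofFn (f' ∘ Sum.inr)) (x' := ofFn (g' ∘ Sum.inl))
      (by simpa [word, Sum.elim_comp_inl, Sum.elim_comp_inr] using h1) (by simp) ?_ ?_
    · rw [List.map_ofFn, List.map_ofFn]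
      congr 1
      funext j
      exact hc j
    · intro d hd s _ t _ hst
      rw [List.map_ofFn, List.map_ofFn] at hd
      exact huniv d (fun j => congrFun (List.ofFn_injective hd) j) s t hst
  involution_mem := by
    rintro k l _ ⟨f, rfl, hf⟩
    exact ⟨_, rfl, (word_swap f).symm ▸ h.reverse hf⟩
  rotateLeft_mem_iff := by
    intro k l p
    obtain ⟨f, rfl⟩ := exists_coloring p
    rw [rotateLeft_ker, ker_mem_ofWords h, ker_mem_ofWords h, word_leftMap]
  rotateRight_mem_iff := by
    intro k l p
    obtain ⟨f, rfl⟩ := exists_coloring p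
    rw [rotateRight_ker, ker_mem_ofWords h, ker_mem_ofWords h]
    obtain ⟨w, h1, h2⟩ := word_rightMap f
    rw [h1, h2]
    exact ⟨fun hw => h.append_comm (v := [_]) hw, fun hw => h.rotate hw⟩
  unit_mem := ⟨fun _ => 0, (top_eq_ker 0).symm,
    by simpa [word] using h.pair⟩
  pair_mem := ⟨fun _ => 0, (top_eq_ker 0).symm,
    by simpa [word] using h.pair⟩

theorem mem_toWords_iff {X : Collection} (w : List ℕ) {n : ℕ} (hn : n = w.length) :
    w ∈ toWords X ↔
      Setoid.ker (Sum.elim Fin.elim0 (fun i => w.get (i.cast hn)) : Fin 0 ⊕ Fin n → ℕ) ∈ X 0 n := by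
  subst hn
  rfl

/-- Left rotation brings all upper points down without changing the word, so the one-row partitions
decide membership. -/
theorem word_mem_toWords {X : Collection} (hX : IsCategory X) {k l : ℕ} (f : Fin k ⊕ Fin l → ℕ) :
    word f ∈ toWords X ↔ Setoid.ker f ∈ X k l := by
  induction k generalizing l with
  | zero =>
    rw [mem_toWords_iff (word f) (n := l) (by simp [length_word])]
    have : (Sum.elim Fin.elim0 (fun i => (word f).get (i.cast (by simp [length_word]))) :
        Fin 0 ⊕ Fin l → ℕ) = f := by
      funext x
      rcases x with x | x
      · exact x.elim0
      · simp only [Sum.elim_inr, word]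
        simp
        rfl
    rw [this]
  | succ k ih => rw [← hX.rotateLeft_mem_iff, rotateLeft_ker, ← ih, word_leftMap]

theorem ofWords_toWords {X : Collection} (hX : IsCategory X) : ofWords (toWords X) = X := by
  funext k l
  ext p
  constructor
  · rintro ⟨f, rfl, hf⟩
    exact (word_mem_toWords hX f).1 hf
  · intro hp
    obtain ⟨f, rfl⟩ := exists_coloring p
    exact ⟨f, rfl, (word_mem_toWords hX f).2 hp⟩

/-- The coloring with given words along the upper and the lower row. -/
def coloring (u v : List ℕ) : Fin u.length ⊕ Fin v.length → ℕ :=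
  Sum.elim (fun i => u.get i.rev) v.get

theorem ofFn_coloring_inl (u v : List ℕ) : (ofFn (coloring u v ∘ Sum.inl)).reverse = u := by
  refine List.ext_getElem (by simp) fun i h1 h2 => ?_
  simp only [coloring, Sum.elim_comp_inl, List.getElem_reverse, List.getElem_ofFn, List.length_ofFn,
    List.get_eq_getElem, Fin.val_rev]
  congr 1
  omega

theorem ofFn_coloring_inr (u v : List ℕ) : ofFn (coloring u v ∘ Sum.inr) = v := by
  simp [coloring, Sum.elim_comp_inr]

theorem word_coloring (u v : List ℕ) : word (coloring u v) = u ++ v := by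
  rw [word, ofFn_coloring_inl, ofFn_coloring_inr]

theorem isWordCategory_toWords {X : Collection} (hX : IsCategory X) :
    IsWordCategory (toWords X) where
  recolor := by
    intro w φ hw hφ
    have hw' : word (coloring [] w) = w := word_coloring [] w
    rw [← hw', word_mem_toWords hX] at hw
    rw [← hw', ← word_comp, word_mem_toWords hX]
    convert hw using 1
    refine Setoid.ext fun x y => ?_
    rw [Setoid.ker_def, Setoid.ker_def]
    refine ⟨fun e => hφ ?_ ?_ e, fun e => congrArg φ e⟩
    · have := mem_word (f := coloring [] w).2 ⟨x, rfl⟩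
      rwa [hw'] at this
    · have := mem_word (f := coloring [] w).2 ⟨y, rfl⟩
      rwa [hw'] at this
  append := by
    intro w w' hw hw' hd
    have e : word (coloring [] w) = w := word_coloring [] w
    have e' : word (coloring [] w') = w' := word_coloring [] w'
    rw [← e, word_mem_toWords hX] at hw
    rw [← e', word_mem_toWords hX] at hw'
    have h1 := hX.tensor_mem _ _ hw hw'
    rw [tensor_ker, ← word_mem_toWords hX] at h1
    · rw [word] at h1
      rw [Sum.elim_comp_inl, Sum.elim_comp_inr, List.ofFn_fin_append, List.ofFn_fin_append] at h1
      simpa [coloring] using h1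
    · intro x y hxy
      exact hd _ (e ▸ mem_word.2 ⟨x, rfl⟩) (e' ▸ mem_word.2 ⟨y, hxy.symm⟩)
  rotate := by
    intro a w hw
    have e : word (coloring [a] w) = a :: w := word_coloring [a] w
    rw [← e, word_mem_toWords hX] at hw
    have h1 := (hX.rotateRight_mem_iff (k := 0) (l := w.length) _).2 hw
    rw [rotateRight_ker, ← word_mem_toWords hX] at h1
    obtain ⟨w', h2, h3⟩ := word_rightMap (k := 0) (l := w.length) (coloring [a] w)
    have h4 := e.symm.trans h2
    simp only [List.cons.injEq] at h4
    erw [h3, ← h4.1, ← h4.2] at h1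
    exact h1
  reverse := by
    intro w hw
    have e : word (coloring [] w) = w := word_coloring [] w
    rw [← e, word_mem_toWords hX] at hw
    have h1 := hX.involution_mem _ hw
    rw [involution_ker, ← word_mem_toWords hX, word_swap, e] at h1
    exact h1
  cap := by
    intro w a b hw
    have e : word (coloring w [a, b]) = w ++ [a, b] := word_coloring w [a, b]
    rw [← e, word_mem_toWords hX] at hw
    obtain ⟨N, hN⟩ := exists_fresh (w ++ [a, b])
    have hlt : ∀ x, coloring w [a, b] x < N := fun x => hN _ (e ▸ mem_word.2 ⟨x, rfl⟩)
    have hcup : Setoid.ker (fun _ : Fin 2 ⊕ Fin 0 => N) ∈ X 2 0 := by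
      have := hX.involution_mem _ hX.pair_mem
      rwa [show pairPartition = Setoid.ker (fun _ => N) from top_eq_ker N,
        involution_ker] at this
    have h1 := hX.comp_mem (l := 2) _ _ hw hcup
    have haN : a < N := hN a (by simp)
    have hbN : b < N := hN b (by simp)
    -- Capping is composition with the upside-down pair partition, coloured by the fresh letter `N`;
    -- its coequalizer identifies `a`, `b` and `N`.
    let c : ℕ → ℕ := fun x => if x = b ∨ x = N then a else x
    have h2 := comp_ker (l := 2) (coloring w [a, b]) (fun _ : Fin 2 ⊕ Fin 0 => N)
      (fun x _ => (hlt x).ne) c (by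
        intro j
        fin_cases j <;> simp [coloring, c]) (by
        intro d hd
        have hda : d a = d N := hd 0
        have hdb : d b = d N := hd 1
        have hdc : ∀ x, d (c x) = d x := by
          intro x
          simp only [c]
          split_ifs with hx
          · rcases hx with rfl | rfl
            · rw [hda, hdb]
            · exact hda
          · rfl
        intro s t hst
        rw [← hdc s, ← hdc t, hst])
    erw [h2, ← word_mem_toWords hX, word_comp] at h1
    convert h1 using 1
    have h3 : word (Sum.elim (coloring w [a, b] ∘ Sum.inl)
        ((fun _ : Fin 2 ⊕ Fin 0 => N) ∘ Sum.inr)) = w := by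
      rw [word, Sum.elim_comp_inl, ofFn_coloring_inl]
      simp
    rw [h3]
    refine List.map_congr_left fun x hx => ?_
    have := hN x (by simp [hx])
    simp [c, merge, this.ne]
  pair := by
    have h1 := hX.pair_mem
    have e : pairPartition = Setoid.ker (fun _ : Fin 0 ⊕ Fin 2 => 0) := top_eq_ker 0
    rw [e, ← word_mem_toWords hX] at h1
    simpa [word] using h1

/-! ### Noncrossing, block sizes and parities read off the word. -/

theorem four_sublist_iff {w : List ℕ} {a b c d : ℕ} : [a, b, c, d] <+ w ↔
    ∃ i j m n : ℕ, i < j ∧ j < m ∧ m < n ∧ w[i]? = some a ∧ w[j]? = some b ∧ w[m]? = some c ∧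
      w[n]? = some d := by
  rw [List.sublist_iff_exists_fin_orderEmbedding_get_eq]
  constructor
  · rintro ⟨g, hg⟩
    have h0 := hg (0 : Fin 4)
    have h1 := hg (1 : Fin 4)
    have h2 := hg (2 : Fin 4)
    have h3 := hg (3 : Fin 4)
    have e : ∀ i : Fin 4, w[(g i : ℕ)]? = some (w.get (g i)) := fun i => by simp
    refine ⟨g (0 : Fin 4), g (1 : Fin 4), g (2 : Fin 4), g (3 : Fin 4), ?_, ?_, ?_, ?_, ?_, ?_, ?_⟩
    · exact g.strictMono (show (0 : Fin 4) < 1 by decide)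
    · exact g.strictMono (show (1 : Fin 4) < 2 by decide)
    · exact g.strictMono (show (2 : Fin 4) < 3 by decide)
    · rw [e, ← h0]; rfl
    · rw [e, ← h1]; rfl
    · rw [e, ← h2]; rfl
    · rw [e, ← h3]; rfl
  · rintro ⟨i, j, m, n, hij, hjm, hmn, ha, hb, hc, hd⟩
    rw [List.getElem?_eq_some_iff] at ha hb hc hd
    obtain ⟨hi, rfl⟩ := ha
    obtain ⟨hj, rfl⟩ := hb
    obtain ⟨hm, rfl⟩ := hc
    obtain ⟨hn, rfl⟩ := hd
    let g : Fin 4 → Fin w.length := ![⟨i, hi⟩, ⟨j, hj⟩, ⟨m, hm⟩, ⟨n, hn⟩]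
    have hg : StrictMono g := by
      rw [Fin.strictMono_iff_lt_succ]
      intro x
      fin_cases x <;> simp [g, hij, hjm, hmn]
    refine ⟨OrderEmbedding.ofStrictMono (α := Fin 4) g hg, fun (ix : Fin 4) => ?_⟩
    fin_cases ix <;> rfl

theorem exists_pos_eq {k l n : ℕ} (h : n < k + l) : ∃ x : Fin k ⊕ Fin l, pos x = n := by
  by_cases hk : n < k
  · exact ⟨Sum.inl (Fin.rev ⟨n, hk⟩), by simp only [pos, Sum.elim_inl, Fin.rev_rev]⟩
  · exact ⟨Sum.inr ⟨n - k, by omega⟩, by simp [pos]; omega⟩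

theorem getElem?_word_pos {k l : ℕ} (f : Fin k ⊕ Fin l → ℕ) (x : Fin k ⊕ Fin l) :
    (word f)[pos x]? = some (f x) := by
  rcases x with x | x
  · have h : (x.rev : ℕ) < k := x.rev.2
    rw [word, pos, Sum.elim_inl, List.getElem?_append_left (by simpa using x.pos),
      List.getElem?_reverse (by simpa using x.pos)]
    simp only [List.length_ofFn, List.getElem?_ofFn, Fin.val_rev]
    rw [dif_pos (by omega)]
    simp only [Function.comp]
    congr 3
    ext
    simp
    omega
  · rw [word, pos, Sum.elim_inr, List.getElem?_append_right (by simp)]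
    simp

theorem noncrossing_ker_iff {k l : ℕ} (f : Fin k ⊕ Fin l → ℕ) :
    Noncrossing (Setoid.ker f) ↔ word f ∈ ncWords := by
  constructor
  · intro h a b hab
    obtain ⟨i, j, m, n, hij, hjm, hmn, ha, hb, hc, hd⟩ := four_sublist_iff.1 hab
    have hlt : n < k + l := by
      rw [← length_word f]
      exact (List.getElem?_eq_some_iff.1 hd).1
    obtain ⟨x, rfl⟩ := exists_pos_eq (show i < k + l by omega)
    obtain ⟨y, rfl⟩ := exists_pos_eq (show j < k + l by omega)
    obtain ⟨z, rfl⟩ := exists_pos_eq (show m < k + l by omega)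
    obtain ⟨t, rfl⟩ := exists_pos_eq hlt
    rw [getElem?_word_pos, Option.some_inj] at ha hb hc hd
    have := h x y z t hij hjm hmn (ha.trans hc.symm) (hb.trans hd.symm)
    exact ha.symm.trans (Eq.trans this hb)
  · intro h x y z t hxy hyz hzt hxz hyt
    refine h (f x) (f y) (four_sublist_iff.2 ⟨_, _, _, _, hxy, hyz, hzt, ?_, ?_, ?_, ?_⟩)
    · exact getElem?_word_pos f x
    · exact getElem?_word_pos f y
    · rw [show f x = f z from hxz]; exact getElem?_word_pos f z
    · rw [show f y = f t from hyt]; exact getElem?_word_pos f t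

theorem count_ofFn {n : ℕ} (f : Fin n → ℕ) (c : ℕ) :
    (ofFn f).count c = ∑ i, if f i = c then 1 else 0 := by
  induction n with
  | zero => simp
  | succ n ih => rw [List.ofFn_succ, Fin.sum_univ_succ, List.count_cons, ih, add_comm]; simp

theorem count_word {k l : ℕ} (f : Fin k ⊕ Fin l → ℕ) (c : ℕ) :
    (word f).count c = {x | f x = c}.ncard := by
  rw [word, List.count_append, List.count_reverse, count_ofFn, count_ofFn,
    Set.ncard_eq_toFinset_card', Set.toFinset_ofPred, Finset.card_filter, Fintype.sum_sum_type]
  rfl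

theorem signedCount_ofFn {n : ℕ} (f : Fin n → ℕ) (c : ℕ) :
    signedCount c (ofFn f) = ∑ i : Fin n, if f i = c then (-1) ^ (i : ℕ) else 0 := by
  induction n with
  | zero => simp [signedCount]
  | succ n ih =>
    rw [List.ofFn_succ, Fin.sum_univ_succ, signedCount, ih, sub_eq_add_neg, ← Finset.sum_neg_distrib]
    congr 1
    refine Finset.sum_congr rfl fun i _ => ?_
    simp only [Fin.val_succ, pow_succ]
    split_ifs <;> simp

theorem signedCount_word {k l : ℕ} (f : Fin k ⊕ Fin l → ℕ) (c : ℕ) :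
    signedCount c (word f) = ∑ x, if f x = c then (-1) ^ pos x else 0 := by
  have hrev : (ofFn (f ∘ Sum.inl)).reverse = ofFn (fun i => f (Sum.inl (Fin.rev i))) := by
    refine List.ext_getElem (by simp) fun i h1 h2 => ?_
    simp only [List.getElem_reverse, List.getElem_ofFn, Function.comp, List.length_ofFn]
    congr 2
    ext
    simp [Fin.val_rev]
    omega
  rw [word, hrev, signedCount_append, signedCount_ofFn, signedCount_ofFn, Fintype.sum_sum_type,
    Finset.mul_sum]
  congr 1
  · rw [← Equiv.sum_comp Fin.revPerm]
    simp [pos]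
  · refine Finset.sum_congr rfl fun i _ => ?_
    simp [pos, pow_add]

theorem forall_classes_ker {α : Type*} {f : α → ℕ} {P : Set α → Prop} :
    (∀ b ∈ (Setoid.ker f).classes, P b) ↔ ∀ y, P {x | f x = f y} := by
  constructor
  · intro h y
    exact h _ ⟨y, rfl⟩
  · rintro h _ ⟨y, rfl⟩
    exact h y

theorem forall_classes_ncard_iff {k l : ℕ} (f : Fin k ⊕ Fin l → ℕ) (P : ℕ → Prop) :
    (∀ b ∈ (Setoid.ker f).classes, P b.ncard) ↔ word f ∈ countWords {n | P n} := by
  rw [forall_classes_ker (P := fun b => P b.ncard)]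
  constructor
  · intro h c hc
    obtain ⟨x, rfl⟩ := mem_word.1 hc
    rw [count_word]
    exact h x
  · intro h x
    have := h (f x) (mem_word.2 ⟨x, rfl⟩)
    rwa [count_word] at this

/-- The block sizes add up to `k + l`, and a sum is even exactly when it has an even number of odd
terms. -/
theorem even_ncard_odd_blocks_iff {k l : ℕ} (p : Partn k l) :
    Even {b ∈ p.classes | Odd b.ncard}.ncard ↔ Even (k + l) := by
  obtain ⟨f, rfl⟩ := exists_coloring p
  classical
  have hcard : ∀ c, {x | f x = c}.ncard = (Finset.univ.filter fun x => f x = c).card := fun c => by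
    rw [Set.ncard_eq_toFinset_card', Set.toFinset_ofPred]
  have h1 : k + l = ∑ c ∈ Finset.univ.image f, {x | f x = c}.ncard := by
    simp_rw [hcard]
    rw [← Finset.card_eq_sum_card_image]
    simp
  rw [h1, Finset.even_sum_iff_even_card_odd, ← Set.ncard_coe_finset]
  have h2 : {b ∈ (Setoid.ker f).classes | Odd b.ncard} = (fun c => {x | f x = c}) ''
      ↑(Finset.filter (fun c => Odd {x | f x = c}.ncard) (Finset.univ.image f)) := by
    ext b
    constructor
    · rintro ⟨⟨y, rfl⟩, hb⟩
      exact ⟨f y, Finset.mem_filter.2 ⟨Finset.mem_image_of_mem f (Finset.mem_univ y), hb⟩, rfl⟩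
    · rintro ⟨c, hc, rfl⟩
      simp only [Finset.coe_filter, Finset.mem_image, Finset.mem_univ, true_and,
        Set.mem_ofPred_eq] at hc
      obtain ⟨⟨y, rfl⟩, hc⟩ := hc
      exact ⟨⟨y, rfl⟩, hc⟩
  rw [h2, Set.InjOn.ncard_image]
  intro c hc d _ hcd
  simp only [Finset.coe_filter, Finset.mem_image, Finset.mem_univ, true_and,
    Set.mem_ofPred_eq] at hc
  obtain ⟨⟨y, rfl⟩, -⟩ := hc
  exact (Set.ext_iff.1 hcd y).1 rfl

theorem even_ncard_odd_blocks_ker_iff {k l : ℕ} (f : Fin k ⊕ Fin l → ℕ) :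
    Even {b ∈ (Setoid.ker f).classes | Odd b.ncard}.ncard ↔ word f ∈ evenWords := by
  rw [even_ncard_odd_blocks_iff, ← length_word f]
  rfl

theorem evenSingletons_ker_iff {k l : ℕ} {f : Fin k ⊕ Fin l → ℕ}
    (h : BlocksOneTwo (Setoid.ker f)) : EvenSingletons (Setoid.ker f) ↔ word f ∈ evenWords := by
  rw [← even_ncard_odd_blocks_ker_iff, EvenSingletons]
  have : {b ∈ (Setoid.ker f).classes | b.ncard = 1} =
      {b ∈ (Setoid.ker f).classes | Odd b.ncard} := by
    ext b
    refine and_congr_right fun hb => ?_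
    rcases h b hb with h | h <;> simp [h]
  rw [this]

theorem blocksOneTwo_ker_iff {k l : ℕ} (f : Fin k ⊕ Fin l → ℕ) :
    BlocksOneTwo (Setoid.ker f) ↔ word f ∈ countWords {1, 2} :=
  forall_classes_ncard_iff f fun n => n = 1 ∨ n = 2

/-- For a block of size two the signed count is a sum of two signs, which vanishes exactly when the
positions have different parity. -/
theorem pairsAlternate_ker_iff {k l : ℕ} (f : Fin k ⊕ Fin l → ℕ) :
    PairsAlternate (Setoid.ker f) ↔
      ∀ c, (word f).count c = 2 → signedCount c (word f) = 0 := by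
  have key : ∀ c, {x | f x = c}.ncard = 2 → (((∃ x ∈ {x | f x = c}, Even (pos x)) ∧
      ∃ y ∈ {x | f x = c}, Odd (pos y)) ↔ signedCount c (word f) = 0) := by
    intro c hc
    obtain ⟨x, y, hxy, hset⟩ := Set.ncard_eq_two.1 hc
    have hfin : (Finset.univ.filter fun x => f x = c) = {x, y} := by
      ext z
      have := Set.ext_iff.1 hset z
      simpa using this
    rw [signedCount_word, ← Finset.sum_filter, hfin, Finset.sum_pair hxy, hset]
    simp only [Set.mem_insert_iff, Set.mem_singleton_iff, exists_eq_or_imp, exists_eq_left]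
    rcases Nat.even_or_odd (pos x) with hx | hx <;> rcases Nat.even_or_odd (pos y) with hy | hy
    · simp [hx.neg_one_pow, hy.neg_one_pow, Nat.not_odd_iff_even.2 hx, Nat.not_odd_iff_even.2 hy]
    · simp [hx.neg_one_pow, hy.neg_one_pow, hx, hy]
    · simp [hx.neg_one_pow, hy.neg_one_pow, hx, hy]
    · simp [hx.neg_one_pow, hy.neg_one_pow, Nat.not_even_iff_odd.2 hx, Nat.not_even_iff_odd.2 hy]
  rw [PairsAlternate, forall_classes_ker (P := fun b => b.ncard = 2 →
    (∃ x ∈ b, Even (pos x)) ∧ ∃ y ∈ b, Odd (pos y))]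
  constructor
  · intro h c hc
    obtain ⟨y, rfl⟩ := mem_word.1 (List.count_pos_iff.1 (show 0 < (word f).count c by omega))
    rw [count_word] at hc
    exact (key _ hc).1 (h y hc)
  · intro h y hy
    refine (key _ hy).2 (h _ ?_)
    rwa [count_word]

theorem mem_altWords_iff {k l : ℕ} (f : Fin k ⊕ Fin l → ℕ) :
    word f ∈ altWords ↔ BlocksOneTwo (Setoid.ker f) ∧ PairsAlternate (Setoid.ker f) ∧
      EvenSingletons (Setoid.ker f) := by
  have h12 : BlocksOneTwo (Setoid.ker f) ↔ ∀ c, (word f).count c ≤ 2 := by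
    rw [blocksOneTwo_ker_iff]
    constructor
    · intro h c
      by_cases hc : c ∈ word f
      · rcases h c hc with h | h <;> simp_all
      · rw [List.count_eq_zero_of_not_mem hc]; omega
    · intro h c hc
      have h1 := h c
      have h2 := List.count_pos_iff.2 hc
      simp only [Set.mem_insert_iff, Set.mem_singleton_iff]
      omega
  constructor
  · rintro ⟨he, h⟩
    have hb := h12.2 fun c => (h c).1
    exact ⟨hb, (pairsAlternate_ker_iff f).2 fun c => (h c).2, (evenSingletons_ker_iff hb).2 he⟩
  · rintro ⟨hb, hp, he⟩
    exact ⟨(evenSingletons_ker_iff hb).1 he,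
      fun c => ⟨h12.1 hb c, (pairsAlternate_ker_iff f).1 hp c⟩⟩

/-! ### The seven word categories and their classification. -/

theorem isWordCategory_evenBlocks : IsWordCategory (ncWords ∩ countWords {n | Even n}) :=
  isWordCategory_ncWords.inter <| isWordCategory_countWords (by decide)
    (fun m n hm hn _ => by
      simp only [Set.mem_ofPred_eq] at *
      rw [Nat.even_iff] at *
      omega)
    (fun n hn _ => by
      simp only [Set.mem_ofPred_eq] at *
      rw [Nat.even_iff] at *
      omega)

theorem isWordCategory_pairs : IsWordCategory (ncWords ∩ countWords {2}) :=
  isWordCategory_ncWords.inter <| isWordCategory_countWords (by simp)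
    (fun m n hm hn _ => by simp only [Set.mem_singleton_iff] at *; omega)
    (fun n hn _ => by simp only [Set.mem_singleton_iff] at *; omega)

theorem isWordCategory_oneTwo : IsWordCategory (ncWords ∩ countWords {1, 2}) :=
  isWordCategory_ncWords.inter <| isWordCategory_countWords (by simp)
    (fun m n hm hn _ => by
      simp only [Set.mem_insert_iff, Set.mem_singleton_iff] at *; omega)
    (fun n hn _ => by simp only [Set.mem_insert_iff, Set.mem_singleton_iff] at *; omega)

/-- The words of the seven categories of noncrossing partitions. -/
def sevenWords : Fin 7 → Set (List ℕ) :=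
  ![ncWords ∩ countWords {2}, ncWords ∩ countWords {n | Even n}, ncWords ∩ evenWords, ncWords,
    ncWords ∩ altWords, ncWords ∩ countWords {1, 2} ∩ evenWords, ncWords ∩ countWords {1, 2}]

theorem isWordCategory_sevenWords (i : Fin 7) : IsWordCategory (sevenWords i) := by
  fin_cases i
  · exact isWordCategory_pairs
  · exact isWordCategory_evenBlocks
  · exact isWordCategory_ncWords.inter isWordCategory_evenWords
  · exact isWordCategory_ncWords
  · exact isWordCategory_ncWords.inter isWordCategory_altWords
  · exact isWordCategory_oneTwo.inter isWordCategory_evenWords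
  · exact isWordCategory_oneTwo

theorem sevenWords_subset_ncWords (i : Fin 7) : sevenWords i ⊆ ncWords := by
  fin_cases i <;> intro w hw
  · exact hw.1
  · exact hw.1
  · exact hw.1
  · exact hw
  · exact hw.1
  · exact hw.1.1
  · exact hw.1

namespace IsWordCategory

variable {L : Set (List ℕ)}

theorem pairs_subset (h : IsWordCategory L) : ncWords ∩ countWords {2} ⊆ L :=
  h.nc_inter_count_subset fun n a hn => by
    obtain rfl : n = 1 := by simpa using hn
    exact h.pair_mem a

theorem evenBlocks_subset (h : IsWordCategory L) (hf : replicate 4 0 ∈ L) :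
    ncWords ∩ countWords {n | Even n} ⊆ L :=
  h.nc_inter_count_subset fun n a hn => by
    obtain ⟨m, hm⟩ : Even (n + 1) := hn
    rw [hm, ← two_mul]
    exact h.replicate_even_mem hf m a

theorem nc_subset (h : IsWordCategory L) (hf : replicate 4 0 ∈ L) (hs : [0] ∈ L) : ncWords ⊆ L :=
  fun _ hw => h.nc_inter_count_subset (B := Set.univ) (fun n a _ => h.replicate_mem hf hs (n + 1) a)
    ⟨hw, fun _ _ => trivial⟩

theorem nc_even_subset (h : IsWordCategory L) (hf : replicate 4 0 ∈ L) (hs : [0, 1] ∈ L) :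
    ncWords ∩ evenWords ⊆ L :=
  fun _ hw => h.nc_inter_count_inter_even_subset (B := Set.univ) (h.positioner_mem hf hs)
    (fun n a _ he => by
      obtain ⟨m, hm⟩ := he
      rw [hm, ← two_mul]
      exact h.replicate_even_mem hf m a)
    (fun n a s _ ho hsa => by
      obtain ⟨m, hm⟩ := ho
      rw [hm]
      exact h.replicate_odd_append_mem hf hs m a s hsa)
    ⟨⟨hw.1, fun _ _ => trivial⟩, hw.2⟩

theorem oneTwo_subset (h : IsWordCategory L) (hs : [0] ∈ L) : ncWords ∩ countWords {1, 2} ⊆ L :=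
  h.nc_inter_count_subset fun n a hn => by
    rcases hn with hn | hn
    · obtain rfl : n = 0 := by simpa using hn
      exact h.recolor_const (n := 1) (a := 0) hs a
    · obtain rfl : n = 1 := by simpa using hn
      exact h.pair_mem a

theorem oneTwo_even_subset (h : IsWordCategory L) (hr : [1, 2, 3, 2] ∈ L) :
    ncWords ∩ countWords {1, 2} ∩ evenWords ⊆ L := by
  refine h.nc_inter_count_inter_even_subset hr (fun n a hn he => ?_) fun n a s hn ho hsa => ?_
  · rcases hn with hn | hn
    · obtain rfl : n = 0 := by simpa using hn
      exact absurd he (by decide)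
    · obtain rfl : n = 1 := by simpa using hn
      exact h.pair_mem a
  · rcases hn with hn | hn
    · obtain rfl : n = 0 := by simpa using hn
      exact h.recolor_two (h.doubleton_mem_of_positioner hr) hsa.symm
    · obtain rfl : n = 1 := by simpa using hn
      exact absurd ho (by decide)

/-- The classification of the categories of noncrossing words. -/
theorem exists_eq_sevenWords (h : IsWordCategory L) (hnc : L ⊆ ncWords) :
    ∃ i, L = sevenWords i := by
  by_cases hs : [0] ∈ L
  · by_cases hf : replicate 4 0 ∈ L
    · exact ⟨3, hnc.antisymm (h.nc_subset hf hs)⟩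
    · refine ⟨6, Set.Subset.antisymm (fun w hw => ⟨hnc hw, fun x hx => ?_⟩) (h.oneTwo_subset hs)⟩
      have h1 := List.count_pos_iff.2 hx
      have h2 : ¬ 3 ≤ w.count x := fun h3 => hf (h.four_mem_of_count hnc hw h3)
      simp only [Set.mem_insert_iff, Set.mem_singleton_iff]
      omega
  have he : L ⊆ evenWords := fun w hw => by
    by_contra ho
    exact hs (h.singleton_mem_of_odd hw (Nat.not_even_iff_odd.1 ho))
  by_cases hf : replicate 4 0 ∈ L
  · by_cases hd : [0, 1] ∈ L
    · exact ⟨2, Set.Subset.antisymm (fun w hw => ⟨hnc hw, he hw⟩) (h.nc_even_subset hf hd)⟩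
    · refine ⟨1, Set.Subset.antisymm (fun w hw => ⟨hnc hw, fun x _ => ?_⟩) (h.evenBlocks_subset hf)⟩
      by_contra ho
      exact hd (h.doubleton_mem_of_odd_count hnc he hw (Nat.not_even_iff_odd.1 ho))
  -- A block of three or more points would produce the excluded four block.
  have hc : L ⊆ countWords {1, 2} := fun w hw x hx => by
    have h1 := List.count_pos_iff.2 hx
    have h2 : ¬ 3 ≤ w.count x := fun h3 => hf (h.four_mem_of_count hnc hw h3)
    simp only [Set.mem_insert_iff, Set.mem_singleton_iff]
    omega
  by_cases hd : [0, 1] ∈ L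
  · by_cases hr : [1, 2, 3, 2] ∈ L
    · exact ⟨5, Set.Subset.antisymm (fun w hw => ⟨⟨hnc hw, hc hw⟩, he hw⟩) (h.oneTwo_even_subset hr)⟩
    · refine ⟨4, Set.Subset.antisymm (fun w hw => ⟨hnc hw, ?_⟩) (h.nc_inter_alt_subset hd)⟩
      by_contra ha
      exact hr (h.positioner_mem_of_not_alt hnc he hc hw ha)
  · refine ⟨0, Set.Subset.antisymm (fun w hw => ⟨hnc hw, fun x hx => ?_⟩) h.pairs_subset⟩
    rcases hc hw x hx with h1 | h1
    · exact absurd (h.doubleton_mem_of_count_eq_one he hw h1) hd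
    · exact h1

end IsWordCategory

/-! ### The generators as words and the categories they generate. -/

theorem fourBlock_eq : fourBlock = Setoid.ker (fun _ : Fin 0 ⊕ Fin 4 => 0) := top_eq_ker 0

theorem singletonPartition_eq : singletonPartition = Setoid.ker (fun _ : Fin 0 ⊕ Fin 1 => 0) :=
  top_eq_ker 0

theorem doubleSingleton_eq : doubleSingleton =
    tensor (Setoid.ker (fun _ : Fin 0 ⊕ Fin 1 => 0)) (Setoid.ker (fun _ : Fin 0 ⊕ Fin 1 => 1)) := by
  rw [doubleSingleton]
  exact congrArg₂ tensor (top_eq_ker 0) (top_eq_ker 1)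

theorem fourBlock_mem_iff {X : Collection} (hX : IsCategory X) :
    fourBlock ∈ X 0 4 ↔ replicate 4 0 ∈ toWords X := by
  rw [fourBlock_eq, ← word_mem_toWords hX]
  simp [word, List.replicate]

theorem singletonPartition_mem_iff {X : Collection} (hX : IsCategory X) :
    singletonPartition ∈ X 0 1 ↔ [0] ∈ toWords X := by
  rw [singletonPartition_eq, ← word_mem_toWords hX]
  simp [word]

theorem doubleSingleton_mem_iff {X : Collection} (hX : IsCategory X) :
    doubleSingleton ∈ X 0 2 ↔ [0, 1] ∈ toWords X := by
  rw [doubleSingleton_eq, tensor_ker _ _ (by simp)]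
  refine (word_mem_toWords hX (k := 0 + 0) (l := 1 + 1) _).symm.trans ?_
  rw [word, Sum.elim_comp_inl, Sum.elim_comp_inr, List.ofFn_fin_append, List.ofFn_fin_append]
  simp

theorem positioner_mem_iff {X : Collection} (hX : IsCategory X) :
    positioner ∈ X 0 4 ↔ [1, 2, 3, 2] ∈ toWords X := by
  rw [positioner, ← word_mem_toWords hX, word, Sum.elim_comp_inl, Sum.elim_comp_inr]
  simp [List.ofFn_succ]

theorem toWords_ofWords {L : Set (List ℕ)} (h : IsWordCategory L) : toWords (ofWords L) = L := by
  ext w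
  have e : word (coloring [] w) = w := word_coloring [] w
  rw [← e, word_mem_toWords (isCategory_ofWords h), ker_mem_ofWords h]

/-- This and the three following membership tables serve twice: to place the generators in their
categories and to separate the seven categories. -/
theorem singleton_mem_sevenWords (i : Fin 7) : [0] ∈ sevenWords i ↔ i = 3 ∨ i = 6 := by
  have hnc : [0] ∈ ncWords := fun a b h => by simpa using h.length_le
  fin_cases i <;> simp [sevenWords, hnc, countWords, evenWords, altWords]

theorem doubleton_mem_sevenWords (i : Fin 7) :
    [0, 1] ∈ sevenWords i ↔ i = 2 ∨ i = 3 ∨ i = 4 ∨ i = 5 ∨ i = 6 := by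
  have hnc : [0, 1] ∈ ncWords := fun a b h => by simpa using h.length_le
  have halt : [0, 1] ∈ altWords := by
    refine ⟨by decide, fun x => ?_⟩
    simp only [List.count_cons, List.count_nil, beq_iff_eq]
    constructor <;> split_ifs <;> omega
  fin_cases i <;> simp [sevenWords, hnc, halt, countWords, evenWords]

theorem four_mem_sevenWords (i : Fin 7) :
    replicate 4 0 ∈ sevenWords i ↔ i = 1 ∨ i = 2 ∨ i = 3 := by
  rw [show replicate 4 0 = [0, 0, 0, 0] from rfl]
  have hnc : [0, 0, 0, 0] ∈ ncWords := fun a b h => by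
    have h1 := h.subset (show a ∈ [a, b, a, b] by simp)
    have h2 := h.subset (show b ∈ [a, b, a, b] by simp)
    simp only [List.mem_cons, List.not_mem_nil, or_false, or_self] at h1 h2
    rw [h1, h2]
  have halt : [0, 0, 0, 0] ∉ altWords := fun h => by
    have := (h.2 0).1
    simp at this
  fin_cases i <;> simp [sevenWords, hnc, halt, countWords, evenWords] <;> decide

theorem positioner_mem_sevenWords (i : Fin 7) :
    [1, 2, 3, 2] ∈ sevenWords i ↔ i = 2 ∨ i = 3 ∨ i = 5 ∨ i = 6 := by
  have hnc : [1, 2, 3, 2] ∈ ncWords := fun a b h => by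
    have := h.eq_of_length rfl
    simp at this
    omega
  have halt : [1, 2, 3, 2] ∉ altWords := fun h => by
    have := (h.2 2).2 (by decide)
    simp [signedCount] at this
  fin_cases i <;> simp [sevenWords, hnc, halt, countWords, evenWords] <;> decide

theorem sevenWords_injective : Function.Injective sevenWords := by
  intro i j hij
  have h1 := (singleton_mem_sevenWords i).symm.trans (hij ▸ singleton_mem_sevenWords j)
  have h2 := (doubleton_mem_sevenWords i).symm.trans (hij ▸ doubleton_mem_sevenWords j)
  have h3 := (four_mem_sevenWords i).symm.trans (hij ▸ four_mem_sevenWords j)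
  have h4 := (positioner_mem_sevenWords i).symm.trans (hij ▸ positioner_mem_sevenWords j)
  clear hij
  revert i j
  decide

/-- Minimality need only be checked on words: every category containing `S` is recovered from its
words. -/
theorem generated_eq_ofWords {S : Set (Σ k l : ℕ, Partn k l)} {L : Set (List ℕ)}
    (hL : IsWordCategory L) (hS : ∀ s ∈ S, s.2.2 ∈ ofWords L s.1 s.2.1)
    (hmin : ∀ X, IsCategory X → (∀ s ∈ S, s.2.2 ∈ X s.1 s.2.1) → L ⊆ toWords X) :
    generated S = ofWords L := by
  funext k l
  refine Set.Subset.antisymm (fun p hp => hp _ (isCategory_ofWords hL) hS) ?_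
  intro p hp X hX hSX
  have := ofWords_mono (hmin X hX hSX) k l hp
  rwa [ofWords_toWords hX] at this

theorem generated_sevenWords :
    generated ∅ = ofWords (sevenWords 0) ∧
    generated {⟨0, 4, fourBlock⟩} = ofWords (sevenWords 1) ∧
    generated {⟨0, 2, doubleSingleton⟩, ⟨0, 4, fourBlock⟩} = ofWords (sevenWords 2) ∧
    generated {⟨0, 1, singletonPartition⟩, ⟨0, 4, fourBlock⟩} = ofWords (sevenWords 3) ∧
    generated {⟨0, 2, doubleSingleton⟩} = ofWords (sevenWords 4) ∧
    generated {⟨0, 4, positioner⟩} = ofWords (sevenWords 5) ∧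
    generated {⟨0, 1, singletonPartition⟩} = ofWords (sevenWords 6) := by
  have hcat := fun i => isCategory_ofWords (isWordCategory_sevenWords i)
  have hto := fun i => toWords_ofWords (isWordCategory_sevenWords i)
  have hf : ∀ i, fourBlock ∈ ofWords (sevenWords i) 0 4 ↔ i = 1 ∨ i = 2 ∨ i = 3 := fun i => by
    rw [fourBlock_mem_iff (hcat i), hto, four_mem_sevenWords]
  have hs : ∀ i, singletonPartition ∈ ofWords (sevenWords i) 0 1 ↔ i = 3 ∨ i = 6 := fun i => by
    rw [singletonPartition_mem_iff (hcat i), hto, singleton_mem_sevenWords]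
  have hd : ∀ i, doubleSingleton ∈ ofWords (sevenWords i) 0 2 ↔
      i = 2 ∨ i = 3 ∨ i = 4 ∨ i = 5 ∨ i = 6 := fun i => by
    rw [doubleSingleton_mem_iff (hcat i), hto, doubleton_mem_sevenWords]
  have hr : ∀ i, positioner ∈ ofWords (sevenWords i) 0 4 ↔ i = 2 ∨ i = 3 ∨ i = 5 ∨ i = 6 :=
    fun i => by rw [positioner_mem_iff (hcat i), hto, positioner_mem_sevenWords]
  refine ⟨?_, ?_, ?_, ?_, ?_, ?_, ?_⟩ <;>
    refine generated_eq_ofWords (isWordCategory_sevenWords _) ?_ fun X hX hS => ?_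
  · simp
  · exact (isWordCategory_toWords hX).pairs_subset
  · simp [hf]
  · simp only [Set.mem_singleton_iff, forall_eq] at hS
    exact (isWordCategory_toWords hX).evenBlocks_subset ((fourBlock_mem_iff hX).1 hS)
  · simp [hf, hd]
  · simp only [Set.mem_insert_iff, Set.mem_singleton_iff, forall_eq_or_imp, forall_eq] at hS
    exact (isWordCategory_toWords hX).nc_even_subset ((fourBlock_mem_iff hX).1 hS.2)
      ((doubleSingleton_mem_iff hX).1 hS.1)
  · simp [hf, hs]
  · simp only [Set.mem_insert_iff, Set.mem_singleton_iff, forall_eq_or_imp, forall_eq] at hS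
    exact (isWordCategory_toWords hX).nc_subset ((fourBlock_mem_iff hX).1 hS.2)
      ((singletonPartition_mem_iff hX).1 hS.1)
  · simp [hd]
  · simp only [Set.mem_singleton_iff, forall_eq] at hS
    exact (isWordCategory_toWords hX).nc_inter_alt_subset ((doubleSingleton_mem_iff hX).1 hS)
  · simp [hr]
  · simp only [Set.mem_singleton_iff, forall_eq] at hS
    exact (isWordCategory_toWords hX).oneTwo_even_subset ((positioner_mem_iff hX).1 hS)
  · simp [hs]
  · simp only [Set.mem_singleton_iff, forall_eq] at hS
    exact (isWordCategory_toWords hX).oneTwo_subset ((singletonPartition_mem_iff hX).1 hS)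

theorem toWords_subset_ncWords {X : Collection} (hX : IsNoncrossingCategory X) :
    toWords X ⊆ ncWords := by
  intro w hw
  have e : word (coloring [] w) = w := word_coloring [] w
  rw [← e, word_mem_toWords hX.toIsCategory] at hw
  rw [← e, ← noncrossing_ker_iff]
  exact hX.noncrossing _ hw

theorem setOf_isNoncrossingCategory :
    {X : Collection | IsNoncrossingCategory X} = Set.range fun i => ofWords (sevenWords i) := by
  ext X
  constructor
  · intro hX
    obtain ⟨i, hi⟩ := (isWordCategory_toWords hX.toIsCategory).exists_eq_sevenWords
      (toWords_subset_ncWords hX)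
    exact ⟨i, by simp only [← hi, ofWords_toWords hX.toIsCategory]⟩
  · rintro ⟨i, rfl⟩
    refine ⟨isCategory_ofWords (isWordCategory_sevenWords i), ?_⟩
    rintro k l _ ⟨f, rfl, hf⟩
    exact (noncrossing_ker_iff f).2 (sevenWords_subset_ncWords i hf)

theorem ofWords_eq_setOf {L : Set (List ℕ)} (hL : IsWordCategory L) {k l : ℕ}
    {P : Partn k l → Prop} (h : ∀ f : Fin k ⊕ Fin l → ℕ, word f ∈ L ↔ P (Setoid.ker f)) :
    ofWords L k l = {p | P p} := by
  ext p
  obtain ⟨f, rfl⟩ := exists_coloring p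
  rw [ker_mem_ofWords hL, h f]
  rfl

end PartitionCategory

theorem theorem2 :
    {X : Collection | IsNoncrossingCategory X}.ncard = 7 ∧
    {X : Collection | IsNoncrossingCategory X} =
      { generated ∅,
        generated {⟨0, 4, fourBlock⟩},
        generated {⟨0, 2, doubleSingleton⟩, ⟨0, 4, fourBlock⟩},
        generated {⟨0, 1, singletonPartition⟩, ⟨0, 4, fourBlock⟩},
        generated {⟨0, 2, doubleSingleton⟩},
        generated {⟨0, 4, positioner⟩},
        generated {⟨0, 1, singletonPartition⟩} } ∧
    (∀ k l : ℕ,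
      generated ∅ k l =
        {p | Noncrossing p ∧ ∀ b ∈ p.classes, b.ncard = 2} ∧
      generated {⟨0, 4, fourBlock⟩} k l =
        {p | Noncrossing p ∧ ∀ b ∈ p.classes, Even b.ncard} ∧
      generated {⟨0, 2, doubleSingleton⟩, ⟨0, 4, fourBlock⟩} k l =
        {p | Noncrossing p ∧ Even {b ∈ p.classes | Odd b.ncard}.ncard} ∧
      generated {⟨0, 1, singletonPartition⟩, ⟨0, 4, fourBlock⟩} k l =
        {p | Noncrossing p} ∧
      generated {⟨0, 2, doubleSingleton⟩} k l =
        {p | Noncrossing p ∧ BlocksOneTwo p ∧ PairsAlternate p ∧ EvenSingletons p} ∧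
      generated {⟨0, 4, positioner⟩} k l =
        {p | Noncrossing p ∧ BlocksOneTwo p ∧ EvenSingletons p} ∧
      generated {⟨0, 1, singletonPartition⟩} k l =
        {p | Noncrossing p ∧ BlocksOneTwo p}) := by
  obtain ⟨h0, h1, h2, h3, h4, h5, h6⟩ := generated_sevenWords
  rw [h0, h1, h2, h3, h4, h5, h6, setOf_isNoncrossingCategory]
  have hrange : (Set.range fun i => ofWords (sevenWords i)) =
      {ofWords (sevenWords 0), ofWords (sevenWords 1), ofWords (sevenWords 2),
        ofWords (sevenWords 3), ofWords (sevenWords 4), ofWords (sevenWords 5),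
        ofWords (sevenWords 6)} := by
    ext X
    simp [Fin.exists_fin_succ, eq_comm]
  refine ⟨?_, hrange, fun k l => ⟨?_, ?_, ?_, ?_, ?_, ?_, ?_⟩⟩
  · rw [Set.ncard_range_of_injective, Nat.card_eq_fintype_card, Fintype.card_fin]
    intro i j hij
    have := congrArg toWords hij
    simp only [toWords_ofWords (isWordCategory_sevenWords _)] at this
    exact sevenWords_injective this
  all_goals
    refine ofWords_eq_setOf (isWordCategory_sevenWords _) fun f => ?_
    rw [noncrossing_ker_iff]
  · exact and_congr_right fun _ => (forall_classes_ncard_iff f fun n => n = 2).symm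
  · exact and_congr_right fun _ => (forall_classes_ncard_iff f fun n => Even n).symm
  · exact and_congr_right fun _ => (even_ncard_odd_blocks_ker_iff f).symm
  · exact Iff.rfl
  · exact and_congr_right fun _ => mem_altWords_iff f
  · refine Iff.trans and_assoc (and_congr_right fun _ => ?_)
    rw [← blocksOneTwo_ker_iff]
    exact and_congr_right fun h => (evenSingletons_ker_iff h).symm
  · exact and_congr_right fun _ => (blocksOneTwo_ker_iff f).symm
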